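/- **Theorem 4.2.** Let $n\ge 2$, let $\Omega\subset\mathbb R^n$ be a bounded open set, let $\lambda>0$, let $a\in L^2(\Omega)$ be non-negative, and let $f\in H^{1/2}(\partial\Omega)$, where $H^{1/2}(\partial\Omega)=H^1(\Omega)/H^1_0(\Omega)$ is the space of traces $v|_{\partial\Omega}$ of functions $v\in H^1(\Omega)$. Assume that the problem $$\min\Big\{\int_\Omega a\,|\nabla v|\,dx \;:\; v\in H^1(\Omega),\ v|_{\partial\Omega}=f\Big\}\tag{P}$$ has a solution. Let $u_f\in H^1(\Omega)$ with $u_f|_{\partial\Omega}=f$, let $b^0,d^0\in (L^2(\Omega))^n$, and let $(\alpha_k)_{k\ge1}$ be real numbers with $\sum_{k=1}^\infty\alpha_k<\infty$. Let $u^{k}\in H^1_0(\Omega)$ ($k\ge 1$) and $d^k,b^k\in(L^2(\Omega))^n$ ($k\ge 0$) be produced by the approximate alternating split Bregman algorithm, i.e. for every $k\ge 0$: 1. $\|\nabla u^{k+1}-\nabla u^{k+1}_{ex}\|_{L^2}\le\alpha_{k+1}$, where $u^{k+1}_{ex}\in H^1_0(\Omega)$ is the weak solution of $\Delta u=\nabla\cdot(d^k-b^k)$,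 $u|_{\partial\Omega}=0$; 2. with $v^{k+1}:=\nabla u^{k+1}+\nabla u_f+b^k$, a.e. in $\Omega$, $$d^{k+1}=\begin{cases}\max\{|v^{k+1}|-\frac a\lambda,0\}\,\dfrac{v^{k+1}}{|v^{k+1}|}-\nabla u_f & \text{if } |v^{k+1}|\ne0,\\ -\nabla u_f&\text{if } |v^{k+1}|=0;\end{cases}$$ 3. $b^{k+1}=b^k+\nabla u^{k+1}-d^{k+1}$. Then there are $\hat b,\hat d\in(L^2(\Omega))^n$ and $\hat u\in H^1_0(\Omega)$ such that $b^k\rightharpoonup\hat b$ and $d^k\rightharpoonup\hat d$ weakly in $(L^2(\Omega))^n$ and $u^k\rightharpoonup\hat u$ weakly in $H^1_0(\Omega)$. Moreover $\nabla u^{k+1}-d^k\to0$ strongly in $(L^2(\Omega))^n$ and $$\sum_{k=0}^\infty\|\nabla u^{k+1}-d^k\|^2<\infty .$$ Furthermore $\bar u:=\hat u+u_f$ is a solution of (P), $\hat d=\nabla\hat u$, $\nabla\cdot\hat b=0$ in $H^{-1}(\Omega)$, and $\lambda\hat b$ is a solution of the dual problem $$-\min_{b\in(L^2(\Omega))^n}\{G^*(-\nabla\cdot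 b)+F^*(b)\},\tag{D}$$ where $F(d)=\int_\Omega a\,|d+\nabla u_f|\,dx$ on $(L^2(\Omega))^n$, $G\equiv0$ on $H^1_0(\Omega)$, and $^*$ denotes the Legendre–Fenchel transform. Finally, $$\hat b=\frac1\lambda\,a\,\frac{\nabla\bar u}{|\nabla\bar u|}\quad\text{a.e. in }\Omega\setminus\{x:|\nabla\bar u(x)|=0,\ a(x)\ne0\},$$ where the right-hand side is read as $0$ at points where $\nabla\bar u=0$ and $a=0$. -/

import Mathlib

open MeasureTheory Filter Topology
open scoped Gradient ContDiff

noncomputable section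

namespace SplitBregman

variable {n : ℕ}

/-- `L²(Ω)`, real valued, with Lebesgue measure on `Ω`. -/
abbrev L2 (Ω : Set (EuclideanSpace ℝ (Fin n))) : Type :=
  Lp ℝ 2 (volume.restrict Ω)

/-- `(L²(Ω))ⁿ`: square-integrable vector fields on `Ω`. -/
abbrev L2Vec (Ω : Set (EuclideanSpace ℝ (Fin n))) : Type :=
  Lp (EuclideanSpace ℝ (Fin n)) 2 (volume.restrict Ω)

/-- Test functions: `φ ∈ C_c^∞(Ω)`. -/
structure IsTestFunction (Ω : Set (EuclideanSpace ℝ (Fin n)))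
    (φ : EuclideanSpace ℝ (Fin n) → ℝ) : Prop where
  smooth : ContDiff ℝ ∞ φ
  compact : HasCompactSupport φ
  support : tsupport φ ⊆ Ω

/-- `g` is the weak gradient of `u` on `Ω`: `∫_Ω u ∇φ = - ∫_Ω φ g` for every `φ ∈ C_c^∞(Ω)`. -/
def IsWeakGradient (Ω : Set (EuclideanSpace ℝ (Fin n))) (u : L2 Ω) (g : L2Vec Ω) : Prop :=
  ∀ φ : EuclideanSpace ℝ (Fin n) → ℝ, IsTestFunction Ω φ →
    ∫ x in Ω, u x • ∇ φ x = - ∫ x in Ω, φ x • g x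

section helpers

variable {Ω : Set (EuclideanSpace ℝ (Fin n))} {φ ψ : EuclideanSpace ℝ (Fin n) → ℝ}

theorem IsTestFunction.zero : IsTestFunction Ω (fun _ => 0) where
  smooth := contDiff_const
  compact := HasCompactSupport.zero
  support := by simp [tsupport]

theorem IsTestFunction.add (hφ : IsTestFunction Ω φ) (hψ : IsTestFunction Ω ψ) :
    IsTestFunction Ω (φ + ψ) where
  smooth := hφ.smooth.add hψ.smooth
  compact := hφ.compact.add hψ.compact
  support := (tsupport_add φ ψ).trans (Set.union_subset hφ.support hψ.support)

theorem IsTestFunction.const_smul (c : ℝ) (hφ : IsTestFunction Ω φ) :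
    IsTestFunction Ω (c • φ) where
  smooth := contDiff_const.smul hφ.smooth
  compact := hφ.compact.smul_left (f := fun _ => c)
  support := (tsupport_smul_subset_right (fun _ => c) φ).trans hφ.support

theorem gradient_zero_fun (x : EuclideanSpace ℝ (Fin n)) :
    ∇ (fun _ : EuclideanSpace ℝ (Fin n) => (0 : ℝ)) x = 0 := by
  simp [gradient]

theorem IsTestFunction.gradient_add (hφ : IsTestFunction Ω φ) (hψ : IsTestFunction Ω ψ)
    (x : EuclideanSpace ℝ (Fin n)) : ∇ (φ + ψ) x = ∇ φ x + ∇ ψ x := by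
  have h1 : DifferentiableAt ℝ φ x := hφ.smooth.differentiable (by simp) x
  have h2 : DifferentiableAt ℝ ψ x := hψ.smooth.differentiable (by simp) x
  simp [gradient, fderiv_add h1 h2]

theorem IsTestFunction.gradient_const_smul (c : ℝ) (hφ : IsTestFunction Ω φ)
    (x : EuclideanSpace ℝ (Fin n)) : ∇ (c • φ) x = c • ∇ φ x := by
  have h1 : DifferentiableAt ℝ φ x := hφ.smooth.differentiable (by simp) x
  simp [gradient, fderiv_const_smul h1]

theorem IsTestFunction.memLp (hφ : IsTestFunction Ω φ) :
    MemLp φ 2 (volume.restrict Ω) :=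
  (hφ.smooth.continuous.memLp_of_hasCompactSupport hφ.compact).restrict Ω

theorem IsTestFunction.memLp_gradient (hφ : IsTestFunction Ω φ) :
    MemLp (∇ φ) 2 (volume.restrict Ω) := by
  have hc : Continuous (∇ φ) :=
    (LinearIsometryEquiv.continuous _).comp (hφ.smooth.continuous_fderiv (by simp))
  have hs : HasCompactSupport (∇ φ) :=
    (hφ.compact.fderiv ℝ).comp_left (by simp)
  exact (hc.memLp_of_hasCompactSupport hs).restrict Ω

theorem integrable_smul_of_memLp {f : EuclideanSpace ℝ (Fin n) → ℝ}
    {g : EuclideanSpace ℝ (Fin n) → EuclideanSpace ℝ (Fin n)}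
    (hf : MemLp f 2 (volume.restrict Ω)) (hg : MemLp g 2 (volume.restrict Ω)) :
    Integrable (fun x => f x • g x) (volume.restrict Ω) :=
  memLp_one_iff_integrable.1 (hg.smul hf)

end helpers

/-- `H¹(Ω)`, realised as the space of pairs `(u, ∇u)` where `u ∈ L²(Ω)` has the weak gradient
`∇u ∈ (L²(Ω))ⁿ`; the norm is `‖(u, ∇u)‖² = ‖u‖² + ‖∇u‖²`. -/
def H1 (Ω : Set (EuclideanSpace ℝ (Fin n))) : Submodule ℝ (WithLp 2 (L2 Ω × L2Vec Ω)) where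
  carrier := {w | IsWeakGradient Ω w.fst w.snd}
  zero_mem' := by
    intro φ hφ
    have h1 : ∫ x in Ω, ((0 : L2 Ω) x) • ∇ φ x = 0 :=
      integral_eq_zero_of_ae (by
        filter_upwards [Lp.coeFn_zero ℝ 2 (volume.restrict Ω)] with x hx
        rw [hx]; simp)
    have h2 : ∫ x in Ω, φ x • ((0 : L2Vec Ω) x) = 0 :=
      integral_eq_zero_of_ae (by
        filter_upwards [Lp.coeFn_zero (EuclideanSpace ℝ (Fin n)) 2 (volume.restrict Ω)] with x hx
        rw [hx]; simp)
    change ∫ x in Ω, ((0 : L2 Ω) x) • ∇ φ x = - ∫ x in Ω, φ x • ((0 : L2Vec Ω) x)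
    rw [h1, h2, neg_zero]
  add_mem' := by
    intro v w hv hw φ hφ
    have h1 : ∫ x in Ω, ((v.fst + w.fst : L2 Ω) x) • ∇ φ x =
        (∫ x in Ω, v.fst x • ∇ φ x) + ∫ x in Ω, w.fst x • ∇ φ x := by
      rw [← integral_add (integrable_smul_of_memLp (Lp.memLp _) hφ.memLp_gradient)
        (integrable_smul_of_memLp (Lp.memLp _) hφ.memLp_gradient)]
      refine integral_congr_ae ?_
      filter_upwards [Lp.coeFn_add v.fst w.fst] with x hx
      rw [hx, Pi.add_apply, add_smul]
    have h2 : ∫ x in Ω, φ x • ((v.snd + w.snd : L2Vec Ω) x) =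
        (∫ x in Ω, φ x • v.snd x) + ∫ x in Ω, φ x • w.snd x := by
      rw [← integral_add (integrable_smul_of_memLp hφ.memLp (Lp.memLp _))
        (integrable_smul_of_memLp hφ.memLp (Lp.memLp _))]
      refine integral_congr_ae ?_
      filter_upwards [Lp.coeFn_add v.snd w.snd] with x hx
      rw [hx, Pi.add_apply, smul_add]
    change ∫ x in Ω, ((v.fst + w.fst : L2 Ω) x) • ∇ φ x =
      - ∫ x in Ω, φ x • ((v.snd + w.snd : L2Vec Ω) x)
    rw [h1, h2, hv φ hφ, hw φ hφ, neg_add]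
  smul_mem' := by
    intro c w hw φ hφ
    have h1 : ∫ x in Ω, ((c • w.fst : L2 Ω) x) • ∇ φ x = c • ∫ x in Ω, w.fst x • ∇ φ x := by
      rw [← integral_smul]
      refine integral_congr_ae ?_
      filter_upwards [Lp.coeFn_smul c w.fst] with x hx
      simp [hx, mul_smul]
    have h2 : ∫ x in Ω, φ x • ((c • w.snd : L2Vec Ω) x) = c • ∫ x in Ω, φ x • w.snd x := by
      rw [← integral_smul]
      refine integral_congr_ae ?_
      filter_upwards [Lp.coeFn_smul c w.snd] with x hx
      simp [hx, smul_comm c]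
    change ∫ x in Ω, ((c • w.fst : L2 Ω) x) • ∇ φ x =
      - ∫ x in Ω, φ x • ((c • w.snd : L2Vec Ω) x)
    rw [h1, h2, hw φ hφ, smul_neg]

variable {Ω : Set (EuclideanSpace ℝ (Fin n))}

instance : NormedAddCommGroup (H1 Ω) := Submodule.normedAddCommGroup (H1 Ω)

instance : InnerProductSpace ℝ (H1 Ω) := Submodule.innerProductSpace (H1 Ω)

/-- The weak gradient `∇ : H¹(Ω) → (L²(Ω))ⁿ`. -/
def grad : H1 Ω →L[ℝ] L2Vec Ω :=
  (WithLp.sndL 2 ℝ (L2 Ω) (L2Vec Ω)).comp (H1 Ω).subtypeL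

/-- `C_c^∞(Ω)` as a subspace of `H¹(Ω)`: the classes `(φ, ∇φ)` of test functions `φ`. -/
def testSubspace (Ω : Set (EuclideanSpace ℝ (Fin n))) : Submodule ℝ (H1 Ω) where
  carrier := {w | ∃ φ : EuclideanSpace ℝ (Fin n) → ℝ, IsTestFunction Ω φ ∧
    (w : WithLp 2 (L2 Ω × L2Vec Ω)).fst =ᵐ[volume.restrict Ω] φ ∧
    (w : WithLp 2 (L2 Ω × L2Vec Ω)).snd =ᵐ[volume.restrict Ω] ∇ φ}
  zero_mem' := by
    refine ⟨fun _ => 0, IsTestFunction.zero, ?_, ?_⟩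
    · exact Lp.coeFn_zero ℝ 2 (volume.restrict Ω)
    · filter_upwards [Lp.coeFn_zero (EuclideanSpace ℝ (Fin n)) 2 (volume.restrict Ω)] with x hx
      rw [gradient_zero_fun]
      exact hx
  add_mem' := by
    rintro v w ⟨φ, hφ, h1, h2⟩ ⟨ψ, hψ, h3, h4⟩
    refine ⟨φ + ψ, hφ.add hψ, ?_, ?_⟩
    · exact (Lp.coeFn_add _ _).trans (h1.add h3)
    · refine (Lp.coeFn_add _ _).trans ((h2.add h4).trans (ae_of_all _ fun x => ?_))
      exact (hφ.gradient_add hψ x).symm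
  smul_mem' := by
    rintro c w ⟨φ, hφ, h1, h2⟩
    refine ⟨c • φ, hφ.const_smul c, ?_, ?_⟩
    · exact (Lp.coeFn_smul _ _).trans (h1.const_smul c)
    · refine (Lp.coeFn_smul _ _).trans ((h2.const_smul c).trans (ae_of_all _ fun x => ?_))
      exact (hφ.gradient_const_smul c x).symm

/-- `H¹₀(Ω)`: the closure of `C_c^∞(Ω)` in `H¹(Ω)`. -/
def H10 (Ω : Set (EuclideanSpace ℝ (Fin n))) : Submodule ℝ (H1 Ω) :=
  (testSubspace Ω).topologicalClosure

instance : NormedAddCommGroup (H10 Ω) := Submodule.normedAddCommGroup (H10 Ω)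

instance : InnerProductSpace ℝ (H10 Ω) := Submodule.innerProductSpace (H10 Ω)

/-- The space of boundary values `H^{1/2}(∂Ω)` of `H¹(Ω)` functions on an arbitrary bounded domain:
the range `H¹(Ω) / H¹₀(Ω)` of the trace map, whose kernel is `H¹₀(Ω)`. -/
abbrev BoundaryValues (Ω : Set (EuclideanSpace ℝ (Fin n))) : Type :=
  H1 Ω ⧸ H10 Ω

/-- The trace `v ↦ v|_{∂Ω}`. -/
def trace : H1 Ω →ₗ[ℝ] BoundaryValues Ω :=
  (H10 Ω).mkQ

/-- The gradient restricted to `H¹₀(Ω)`. -/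
def grad0 : H10 Ω →L[ℝ] L2Vec Ω :=
  grad.comp (H10 Ω).subtypeL

/-- The divergence `∇ · p ∈ H⁻¹(Ω) = (H¹₀(Ω))*` of `p ∈ (L²(Ω))ⁿ`:
`⟨∇ · p, w⟩ = - ∫_Ω p · ∇w`. -/
def divergence (p : L2Vec Ω) : StrongDual ℝ (H10 Ω) :=
  -((innerSL ℝ p).comp grad0)

/-- `w ∈ H¹₀(Ω)` is the (exact, weak) solution of `Δw = ∇ · p`, `w|_{∂Ω} = 0`. -/
def IsPoissonSolution (p : L2Vec Ω) (w : H10 Ω) : Prop :=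
  divergence (grad0 w) = divergence p

/-- The weighted total variation `∫_Ω a |∇v|`. -/
def energy (a : L2 Ω) (v : H1 Ω) : ℝ :=
  ∫ x in Ω, a x * ‖grad v x‖

/-- `v` solves the weighted least gradient problem
`min {∫_Ω a |∇v| : v ∈ H¹(Ω), v|_{∂Ω} = f}`. -/
def IsLeastGradientSolution (a : L2 Ω) (f : BoundaryValues Ω) (v : H1 Ω) : Prop :=
  trace v = f ∧ ∀ w : H1 Ω, trace w = f → energy a v ≤ energy a w

/-- The Legendre-Fenchel transform `F*(ℓ) = sup {⟨d, ℓ⟩ - F(d)}` of a real-valued functional. -/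
def fenchelConj {E : Type*} [NormedAddCommGroup E] [NormedSpace ℝ E] (F : E → ℝ)
    (l : StrongDual ℝ E) : EReal :=
  ⨆ d : E, ((l d - F d : ℝ) : EReal)

/-- `F(d) = ∫_Ω a |d + ∇u_f|`. -/
def functionalF (a : L2 Ω) (uf : H1 Ω) (d : L2Vec Ω) : ℝ :=
  ∫ x in Ω, a x * ‖d x + grad uf x‖

/-- `G ≡ 0` on `H¹₀(Ω)`. -/
def functionalG (_u : H10 Ω) : ℝ := 0

/-- The functional `G*(-∇ · b) + F*(b)`; `F*` is evaluated at `b` by the Riesz identification of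
`(L²(Ω))ⁿ` with its dual. -/
def dualObjective (a : L2 Ω) (uf : H1 Ω) (b : L2Vec Ω) : EReal :=
  fenchelConj (E := H10 Ω) functionalG (-divergence b) + fenchelConj (functionalF a uf) (innerSL ℝ b)

/-- `b` solves the dual problem `- min {G*(-∇ · b) + F*(b) : b ∈ (L²(Ω))ⁿ}`. -/
def IsDualSolution (a : L2 Ω) (uf : H1 Ω) (b : L2Vec Ω) : Prop :=
  ∀ c : L2Vec Ω, dualObjective a uf b ≤ dualObjective a uf c

/-- `max {|v| - t, 0} v / |v|` if `v ≠ 0`, and `0` if `v = 0`. -/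
def shrink (t : ℝ) (v : EuclideanSpace ℝ (Fin n)) : EuclideanSpace ℝ (Fin n) :=
  open Classical in if v ≠ 0 then (max (‖v‖ - t) 0 / ‖v‖) • v else 0

/-- `(u, d, b)` is produced by the approximate alternating split Bregman algorithm with parameter
`lam`, error bounds `α` and initial fields `b 0`, `d 0`. The value `u 0` plays no role. -/
structure IsApproxSplitBregman (a : L2 Ω) (uf : H1 Ω) (lam : ℝ) (α : ℕ → ℝ)
    (u : ℕ → H10 Ω) (d b : ℕ → L2Vec Ω) : Prop where
  /-- `u^{k+1}` approximates the exact solution of `Δu = ∇ · (d^k - b^k)`, `u|_{∂Ω} = 0`. -/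
  step_u : ∀ k, ∃ uex : H10 Ω, IsPoissonSolution (d k - b k) uex ∧
    ‖grad0 (u (k + 1)) - grad0 uex‖ ≤ α (k + 1)
  step_d : ∀ k, ∀ᵐ x ∂(volume.restrict Ω),
    d (k + 1) x = shrink (a x / lam) (grad0 (u (k + 1)) x + grad uf x + b k x) - grad uf x
  step_b : ∀ k, b (k + 1) = b k + grad0 (u (k + 1)) - d (k + 1)

/-- Weak convergence of a sequence in a real normed space. -/
def WeaklyTendsto {E : Type*} [NormedAddCommGroup E] [NormedSpace ℝ E] (x : ℕ → E) (y : E) : Prop :=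
  Tendsto (fun k => toWeakSpace ℝ E (x k)) atTop (𝓝 (toWeakSpace ℝ E y))

end SplitBregman

end

open SplitBregman

/-!
The algorithm is an inexact Douglas–Rachford iteration in `(L²(Ω))ⁿ`. Let `V = ∇H¹₀(Ω)`, with
orthogonal projection `P`, and let `J z = shrink (a / lam) (z + ∇u_f) - ∇u_f`; pointwise convexity
(`inner_sub_shrink_le`) shows that `lam (z - J z)` is a subgradient of `F` at `J z`, so `J` is the
resolvent of `lam⁻¹ ∂F` (`functionalF_subgradient`). The exact Poisson step is
`∇u_ex^{k+1} = P (d^k - b^k)`, and `z^k = d^k + b^k` satisfies, for `k ≥ 1`, `d^k = J z^k` and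
`z^{k+1} = (b^k - P b^k) + P d^k` up to an error of norm at most `α_{k+1}`.

A fixed point is a pair `d ∈ V`, `b ∈ Vᗮ` with `J (d + b) = d`. One exists because a solution of
the least gradient problem minimises the convex continuous `F` over `V`, so Hahn–Banach gives a
subgradient orthogonal to `V` (`exists_subgradient_mem_orthogonal`). Firm nonexpansiveness
(`douglasRachford_norm_sq_le`) makes the distances of `z^k` to fixed points converge and makes the
squared norms of the residuals `(d^k - P d^k) + P b^k` summable. As the two summands are
orthogonal, `d^k - P d^k` and `P b^k` tend to zero; hence `⟪d^k, b^k⟫ → 0`, which lets the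
monotonicity inequality of `J` pass to weak limits, and Opial's lemma gives weak convergence of
`z^k`. Linearity of `P` then transfers it to `d^k` and to `b^k` separately
(`exists_weaklyTendsto_douglasRachford`).

The Poincaré inequality on `H¹₀(Ω)` makes `V` closed and `u` a continuous function of `∇u`, which
gives the weak convergence of `u^k`. The limit is a fixed point, that is `dhat` is a gradient,
`bhat` is divergence free and `lam bhat ∈ ∂F(dhat)`; this is the optimality condition for the primal and
for the dual problem, and reading `J (dhat + bhat) = dhat` pointwise gives the formula for `bhat`.
-/

namespace SplitBregman

open scoped InnerProductSpace

/-! ### Weak convergence in Hilbert spaces -/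

section WeakConvergence

variable {E : Type*} [NormedAddCommGroup E]

theorem weaklyTendsto_iff_forall_dual [NormedSpace ℝ E] {x : ℕ → E} {y : E} :
    WeaklyTendsto x y ↔ ∀ l : StrongDual ℝ E, Tendsto (fun k => l (x k)) atTop (𝓝 (l y)) := by
  unfold WeaklyTendsto
  have hind : Topology.IsInducing
      (fun (z : WeakSpace ℝ E) (l : StrongDual ℝ E) => l ((toWeakSpace ℝ E).symm z)) := ⟨rfl⟩
  rw [hind.tendsto_nhds_iff, tendsto_pi_nhds]
  rfl

theorem weaklyTendsto_iff_forall_inner [InnerProductSpace ℝ E] [CompleteSpace E]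
    {x : ℕ → E} {y : E} :
    WeaklyTendsto x y ↔ ∀ p : E, Tendsto (fun k => ⟪p, x k⟫_ℝ) atTop (𝓝 ⟪p, y⟫_ℝ) := by
  rw [weaklyTendsto_iff_forall_dual, (InnerProductSpace.toDual ℝ E).surjective.forall]
  simp only [InnerProductSpace.toDual_apply_apply]

theorem WeaklyTendsto.map {F : Type*} [NormedAddCommGroup F] [NormedSpace ℝ E] [NormedSpace ℝ F]
    {x : ℕ → E} {y : E} (h : WeaklyTendsto x y) (S : E →L[ℝ] F) :
    WeaklyTendsto (fun k => S (x k)) (S y) := by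
  rw [weaklyTendsto_iff_forall_dual] at h ⊢
  exact fun l => h (l.comp S)

theorem WeaklyTendsto.add_of_tendsto_zero [NormedSpace ℝ E]
    {x e : ℕ → E} {y : E} (h : WeaklyTendsto x y) (he : Tendsto e atTop (𝓝 0)) :
    WeaklyTendsto (fun k => x k + e k) y := by
  rw [weaklyTendsto_iff_forall_dual] at h ⊢
  intro l
  have h0 : Tendsto (fun k => l (e k)) atTop (𝓝 0) := by
    simpa [Function.comp_def] using (l.continuous.tendsto 0).comp he
  simpa using (h l).add h0

theorem WeaklyTendsto.of_shift [NormedSpace ℝ E] {x : ℕ → E} {y : E}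
    (h : WeaklyTendsto (fun k => x (k + 1)) y) : WeaklyTendsto x y := by
  unfold WeaklyTendsto at h ⊢
  exact (tendsto_add_atTop_iff_nat 1).1 h

/-- Weak compactness of bounded sequences, stated with an ultrafilter in place of a
subsequence, which makes separability of the space irrelevant. -/
theorem exists_weak_limit_ultrafilter [InnerProductSpace ℝ E] [CompleteSpace E]
    {z : ℕ → E} {R : ℝ} (hz : ∀ k, ‖z k‖ ≤ R) (U : Ultrafilter ℕ) :
    ∃ y : E, ∀ p : E, Tendsto (fun k => ⟪p, z k⟫_ℝ) U (𝓝 ⟪p, y⟫_ℝ) := by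
  let D : ℕ → WeakDual ℝ E := fun k =>
    StrongDual.toWeakDual (InnerProductSpace.toDual ℝ E (z k))
  have hK : IsCompact (WeakDual.toStrongDual ⁻¹' Metric.closedBall (0 : StrongDual ℝ E) R) :=
    WeakDual.isCompact_closedBall 0 R
  have hmem : ∀ k, D k ∈ WeakDual.toStrongDual ⁻¹' Metric.closedBall (0 : StrongDual ℝ E) R := by
    intro k
    simp only [Set.mem_preimage, mem_closedBall_zero_iff]
    change ‖InnerProductSpace.toDual ℝ E (z k)‖ ≤ R
    simpa using hz k
  obtain ⟨L, -, hL⟩ := hK.ultrafilter_le_nhds (U.map D)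
    (le_principal_iff.2 (Filter.mem_map.2 (Filter.univ_mem' hmem)))
  obtain ⟨y, hy⟩ := (InnerProductSpace.toDual ℝ E).surjective (WeakDual.toStrongDual L)
  refine ⟨y, fun p => ?_⟩
  have h1 : Tendsto (fun k => D k p) U (𝓝 (L p)) :=
    ((WeakDual.eval_continuous p).tendsto L).comp hL
  have h2 : L p = ⟪y, p⟫_ℝ := by
    rw [← InnerProductSpace.toDual_apply_apply, hy]; rfl
  rw [h2, real_inner_comm] at h1
  refine h1.congr fun k => ?_
  rw [real_inner_comm]; rfl

/-- **Opial's lemma.** If the distances to each point of `C` converge and all weak limits along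
ultrafilters lie in `C`, then the sequence converges weakly to a point of `C`. -/
theorem exists_weaklyTendsto_of_opial [InnerProductSpace ℝ E] [CompleteSpace E]
    {z : ℕ → E} {R : ℝ} (hz : ∀ k, ‖z k‖ ≤ R) (C : Set E)
    (hC : ∀ p ∈ C, ∃ r : ℝ, Tendsto (fun k => ‖z k - p‖) atTop (𝓝 r))
    (hlim : ∀ (U : Ultrafilter ℕ) (y : E), (U : Filter ℕ) ≤ atTop →
      (∀ p : E, Tendsto (fun k => ⟪p, z k⟫_ℝ) U (𝓝 ⟪p, y⟫_ℝ)) → y ∈ C) :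
    ∃ y ∈ C, WeaklyTendsto z y := by
  have huniq : ∀ (U W : Ultrafilter ℕ) (p q : E), (U : Filter ℕ) ≤ atTop →
      (W : Filter ℕ) ≤ atTop →
      (∀ e : E, Tendsto (fun k => ⟪e, z k⟫_ℝ) U (𝓝 ⟪e, p⟫_ℝ)) →
      (∀ e : E, Tendsto (fun k => ⟪e, z k⟫_ℝ) W (𝓝 ⟪e, q⟫_ℝ)) → p = q := by
    intro U W p q hU hW hp hq
    obtain ⟨r, hr⟩ := hC p (hlim U p hU hp)
    obtain ⟨s, hs⟩ := hC q (hlim W q hW hq)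
    -- `2 ⟪q - p, z k⟫ = ‖z k - p‖² - ‖z k - q‖² + const` has a limit along the whole sequence.
    have hc : Tendsto (fun k => ⟪q - p, z k⟫_ℝ) atTop
        (𝓝 ((r ^ 2 - s ^ 2 - ‖p‖ ^ 2 + ‖q‖ ^ 2) / 2)) := by
      refine (((((hr.pow 2).sub (hs.pow 2)).sub_const (‖p‖ ^ 2)).add_const (‖q‖ ^ 2)).div_const
        2).congr fun k => ?_
      rw [@norm_sub_sq_real, @norm_sub_sq_real, inner_sub_left, real_inner_comm p,
        real_inner_comm q]
      ring
    have h1 := tendsto_nhds_unique (hp (q - p)) (hc.mono_left hU)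
    have h2 := tendsto_nhds_unique (hq (q - p)) (hc.mono_left hW)
    have h3 : ⟪q - p, q - p⟫_ℝ = 0 := by rw [inner_sub_right, h1, h2, sub_self]
    exact (sub_eq_zero.1 (inner_self_eq_zero.1 h3)).symm
  obtain ⟨y, hy⟩ := exists_weak_limit_ultrafilter hz (hyperfilter ℕ)
  have hH : ((hyperfilter ℕ : Ultrafilter ℕ) : Filter ℕ) ≤ atTop := Nat.hyperfilter_le_atTop
  refine ⟨y, hlim _ y hH hy, weaklyTendsto_iff_forall_inner.2 fun p => ?_⟩
  rw [tendsto_iff_ultrafilter]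
  intro W hW
  obtain ⟨q, hq⟩ := exists_weak_limit_ultrafilter hz W
  rw [huniq _ W y q hH hW hy hq]
  exact hq p

end WeakConvergence

/-! ### Quasi-Fejér sequences -/

theorem exists_tendsto_of_le_add_summable {r ε : ℕ → ℝ} (hr : ∀ k, 0 ≤ r k) (hε : ∀ k, 0 ≤ ε k)
    (hs : Summable ε) (h : ∀ k, r (k + 1) ≤ r k + ε k) : ∃ l, Tendsto r atTop (𝓝 l) := by
  let S : ℕ → ℝ := fun k => ∑ i ∈ Finset.range k, ε i
  have hanti : Antitone fun k => r k - S k := antitone_nat_of_succ_le fun k => by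
    simp only [S, Finset.sum_range_succ]; linarith [h k]
  have hbdd : BddBelow (Set.range fun k => r k - S k) := by
    refine ⟨-∑' i, ε i, ?_⟩
    rintro _ ⟨k, rfl⟩
    have := hs.sum_le_tsum (Finset.range k) fun i _ => hε i
    simp only [S]; linarith [hr k]
  refine ⟨_, ((tendsto_atTop_ciInf hanti hbdd).add hs.hasSum.tendsto_sum_nat).congr fun k => ?_⟩
  simp [S]

theorem summable_of_le_sub_add {r s ε : ℕ → ℝ} (hr : ∀ k, 0 ≤ r k) (hs0 : ∀ k, 0 ≤ s k)
    (hε : ∀ k, 0 ≤ ε k) (hε' : Summable ε) (h : ∀ k, r (k + 1) ≤ r k - s k + ε k) :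
    Summable s := by
  refine summable_of_sum_range_le (c := r 0 + ∑' i, ε i) hs0 fun m => ?_
  have h1 : ∀ m, r m + ∑ i ∈ Finset.range m, s i ≤ r 0 + ∑ i ∈ Finset.range m, ε i := by
    intro m
    induction m with
    | zero => simp
    | succ m ih => rw [Finset.sum_range_succ, Finset.sum_range_succ]; linarith [h m]
  have h2 := hε'.sum_le_tsum (Finset.range m) fun i _ => hε i
  linarith [h1 m, hr m]

/-! ### Inexact Douglas–Rachford iteration with a subspace -/

section DouglasRachford

variable {H : Type*} [NormedAddCommGroup H] [InnerProductSpace ℝ H]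

/-- `J` is the resolvent of a monotone relation: the pairs `(J z, z - J z)` are monotone. -/
def IsFirmlyNonexpansive (J : H → H) : Prop :=
  ∀ z w, 0 ≤ ⟪J z - J w, (z - J z) - (w - J w)⟫_ℝ

theorem norm_starProjection_sub_add_sq (V : Submodule ℝ H) [V.HasOrthogonalProjection] (x y : H) :
    ‖(x - V.starProjection x) + V.starProjection y‖ ^ 2 =
      ‖x - V.starProjection x‖ ^ 2 + ‖V.starProjection y‖ ^ 2 := by
  rw [@norm_add_sq_real, V.starProjection_inner_eq_zero x _ (V.starProjection_apply_mem y)]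
  ring

theorem norm_sq_eq_starProjection (V : Submodule ℝ H) [V.HasOrthogonalProjection] (x : H) :
    ‖x‖ ^ 2 = ‖x - V.starProjection x‖ ^ 2 + ‖V.starProjection x‖ ^ 2 := by
  rw [← norm_starProjection_sub_add_sq, sub_add_cancel]

theorem inner_eq_starProjection_add (V : Submodule ℝ H) [V.HasOrthogonalProjection] (x y : H) :
    ⟪x, y⟫_ℝ = ⟪V.starProjection x, V.starProjection y⟫_ℝ +
      ⟪x - V.starProjection x, y - V.starProjection y⟫_ℝ := by
  have h1 := V.starProjection_inner_eq_zero x _ (V.starProjection_apply_mem y)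
  have h2 := V.starProjection_inner_eq_zero y _ (V.starProjection_apply_mem x)
  rw [real_inner_comm] at h2
  have h3 : ⟪x, y⟫_ℝ = ⟪(x - V.starProjection x) + V.starProjection x,
      (y - V.starProjection y) + V.starProjection y⟫_ℝ := by simp
  rw [h3]
  simp only [inner_add_left, inner_add_right]
  rw [h1, h2]; ring

/-- The Douglas–Rachford map `T (d + b) = Vᗮ-part of b + V-part of d` is firmly nonexpansive
relative to the point `d' + b'`, which it fixes since `d' ∈ V` and `b' ∈ Vᗮ`. -/
theorem douglasRachford_norm_sq_le (V : Submodule ℝ H) [V.HasOrthogonalProjection] {d b d' b' : H}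
    (hd' : d' ∈ V) (hb' : b' ∈ Vᗮ) (hmono : 0 ≤ ⟪d - d', b - b'⟫_ℝ) :
    ‖(b - V.starProjection b + V.starProjection d) - (d' + b')‖ ^ 2 +
      ‖(d - V.starProjection d) + V.starProjection b‖ ^ 2 ≤ ‖(d + b) - (d' + b')‖ ^ 2 := by
  have hPd : V.starProjection d' = d' := V.starProjection_eq_self_iff.2 hd'
  have hPb : V.starProjection b' = 0 := V.starProjection_apply_eq_zero_iff.2 hb'
  have e1 : (b - V.starProjection b + V.starProjection d) - (d' + b') =
      ((b - b') - V.starProjection (b - b')) + V.starProjection (d - d') := by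
    rw [map_sub, map_sub, hPd, hPb]; abel
  have e2 : (d - V.starProjection d) + V.starProjection b =
      ((d - d') - V.starProjection (d - d')) + V.starProjection (b - b') := by
    rw [map_sub, map_sub, hPd, hPb]; abel
  have e3 : (d + b) - (d' + b') = (d - d') + (b - b') := by abel
  rw [e1, e2, e3, norm_starProjection_sub_add_sq, norm_starProjection_sub_add_sq,
    @norm_add_sq_real]
  have h1 := norm_sq_eq_starProjection V (d - d')
  have h2 := norm_sq_eq_starProjection V (b - b')
  linarith

/-- Weak convergence of the inexact Douglas–Rachford iteration for the resolvent `J` and a closed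
subspace `V`. Since the projection onto `V` is linear, both components `d k` and `b k` of
`z k = d k + b k` converge weakly, and not only `z k`. -/
theorem exists_weaklyTendsto_douglasRachford [CompleteSpace H] (V : Submodule ℝ H)
    [V.HasOrthogonalProjection] {J : H → H} (hJ : IsFirmlyNonexpansive J)
    {d' b' : H} (hd' : d' ∈ V) (hb' : b' ∈ Vᗮ) (hfix : J (d' + b') = d')
    {d b : ℕ → H} {ε : ℕ → ℝ} (hε : Summable ε) (hd : ∀ k, d k = J (d k + b k))
    (hstep : ∀ k, ‖(d (k + 1) + b (k + 1)) -
      (b k - V.starProjection (b k) + V.starProjection (d k))‖ ≤ ε k) :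
    ∃ dhat ∈ V, ∃ bhat ∈ Vᗮ, J (dhat + bhat) = dhat ∧ WeaklyTendsto d dhat ∧
      WeaklyTendsto b bhat ∧
      Summable fun k => ‖(d k - V.starProjection (d k)) + V.starProjection (b k)‖ ^ 2 := by
  have hε0 : ∀ k, 0 ≤ ε k := fun k => (norm_nonneg _).trans (hstep k)
  -- `T k` and `S k` stand for `T (z k)` and `z k - T (z k)`.
  set T : ℕ → H := fun k => b k - V.starProjection (b k) + V.starProjection (d k) with hT
  set S : ℕ → H := fun k => (d k - V.starProjection (d k)) + V.starProjection (b k) with hS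
  have hmono : ∀ (p q : H), J (p + q) = p → ∀ k, 0 ≤ ⟪d k - p, b k - q⟫_ℝ := by
    intro p q hpq k
    have h := hJ (d k + b k) (p + q)
    rw [← hd k, hpq] at h
    simpa using h
  have hfejer : ∀ p ∈ V, ∀ q ∈ Vᗮ, J (p + q) = p → ∀ k,
      ‖T k - (p + q)‖ ^ 2 + ‖S k‖ ^ 2 ≤ ‖(d k + b k) - (p + q)‖ ^ 2 := fun p hp q hq hpq k =>
    douglasRachford_norm_sq_le V hp hq (hmono p q hpq k)
  have hT_le : ∀ p ∈ V, ∀ q ∈ Vᗮ, J (p + q) = p → ∀ k,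
      ‖T k - (p + q)‖ ≤ ‖(d k + b k) - (p + q)‖ := fun p hp q hq hpq k =>
    le_of_sq_le_sq (by linarith [hfejer p hp q hq hpq k, sq_nonneg ‖S k‖]) (norm_nonneg _)
  have hz_le : ∀ (c : H) k, ‖(d (k + 1) + b (k + 1)) - c‖ ≤ ‖T k - c‖ + ε k := by
    intro c k
    have h : (d (k + 1) + b (k + 1)) - c = (T k - c) + ((d (k + 1) + b (k + 1)) - T k) := by abel
    rw [h]
    exact (norm_add_le _ _).trans (by linarith [hstep k])
  have hconv : ∀ p ∈ V, ∀ q ∈ Vᗮ, J (p + q) = p →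
      ∃ r, Tendsto (fun k => ‖(d k + b k) - (p + q)‖) atTop (𝓝 r) := fun p hp q hq hpq =>
    exists_tendsto_of_le_add_summable (fun _ => norm_nonneg _) hε0 hε fun k => by
      linarith [hz_le (p + q) k, hT_le p hp q hq hpq k]
  obtain ⟨r, hr⟩ := hconv d' hd' b' hb' hfix
  obtain ⟨R, hR⟩ := hr.bddAbove_range
  have hR' : ∀ k, ‖(d k + b k) - (d' + b')‖ ≤ R := fun k => hR ⟨k, rfl⟩
  obtain ⟨M, hM⟩ := hε.tendsto_atTop_zero.bddAbove_range
  have hM' : ∀ k, ε k ≤ M := fun k => hM ⟨k, rfl⟩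
  have hsum : Summable fun k => ‖S k‖ ^ 2 := by
    refine summable_of_le_sub_add (r := fun k => ‖(d k + b k) - (d' + b')‖ ^ 2)
      (ε := fun k => (2 * R + M) * ε k) (fun _ => sq_nonneg _) (fun _ => sq_nonneg _)
      (fun k => ?_) (hε.mul_left _) fun k => ?_
    · have h1 := (norm_nonneg _).trans (hR' 0)
      have h2 := (hε0 0).trans (hM' 0)
      exact mul_nonneg (by linarith) (hε0 k)
    · have h1 := hz_le (d' + b') k
      have h2 := hfejer d' hd' b' hb' hfix k
      have h3 := (hT_le d' hd' b' hb' hfix k).trans (hR' k)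
      have h4 := pow_le_pow_left₀ (norm_nonneg _) h1 2
      have h5 := mul_le_mul_of_nonneg_right h3 (hε0 k)
      have h6 := mul_le_mul_of_nonneg_right (hM' k) (hε0 k)
      have h7 : (‖T k - (d' + b')‖ + ε k) ^ 2 =
        ‖T k - (d' + b')‖ ^ 2 + 2 * (‖T k - (d' + b')‖ * ε k) + ε k * ε k := by ring
      change _ ≤ _ - _ + (2 * R + M) * ε k
      have h8 : (2 * R + M) * ε k = 2 * (R * ε k) + M * ε k := by ring
      rw [h8]
      linarith
  have hS0 : Tendsto S atTop (𝓝 0) := by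
    rw [tendsto_zero_iff_norm_tendsto_zero]
    have := hsum.tendsto_atTop_zero.sqrt
    simpa using this
  -- The two orthogonal components of `S k` tend to zero separately.
  have hPb : Tendsto (fun k => V.starProjection (b k)) atTop (𝓝 0) := by
    have h := (V.starProjection.continuous.tendsto 0).comp hS0
    rw [map_zero] at h
    refine h.congr fun k => ?_
    have h1 : V.starProjection (d k - V.starProjection (d k)) = 0 :=
      V.starProjection_apply_eq_zero_iff.2 (V.sub_starProjection_mem_orthogonal _)
    have h2 : V.starProjection (V.starProjection (b k)) = V.starProjection (b k) :=
      V.starProjection_eq_self_iff.2 (V.starProjection_apply_mem _)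
    simp only [Function.comp, hS, map_add, h1, h2, zero_add]
  have hPd : Tendsto (fun k => d k - V.starProjection (d k)) atTop (𝓝 0) := by
    have := hS0.sub hPb
    simpa [hS] using this
  have hzb : ∀ k, ‖d k + b k‖ ≤ R + ‖d' + b'‖ := fun k => by
    have h : d k + b k = ((d k + b k) - (d' + b')) + (d' + b') := by abel
    rw [h]
    exact (norm_add_le _ _).trans (by linarith [hR' k])
  have hPz : ∀ k, ‖V.starProjection (d k)‖ ≤ R + ‖d' + b'‖ + ‖V.starProjection (b k)‖ := by
    intro k
    have h : V.starProjection (d k) = V.starProjection (d k + b k) - V.starProjection (b k) := by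
      rw [map_add]; abel
    rw [h]
    have h1 := V.norm_starProjection_apply_le (d k + b k)
    exact (norm_sub_le _ _).trans (by linarith [hzb k])
  have hQz : ∀ k, ‖b k - V.starProjection (b k)‖ ≤
      R + ‖d' + b'‖ + ‖d k - V.starProjection (d k)‖ := by
    intro k
    have h : b k - V.starProjection (b k) =
        ((d k + b k) - V.starProjection (d k + b k)) - (d k - V.starProjection (d k)) := by
      rw [map_add]; abel
    rw [h]
    have h1 : ‖(d k + b k) - V.starProjection (d k + b k)‖ ≤ ‖d k + b k‖ := by
      refine le_of_sq_le_sq ?_ (norm_nonneg _)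
      linarith [norm_sq_eq_starProjection V (d k + b k),
        sq_nonneg ‖V.starProjection (d k + b k)‖]
    exact (norm_sub_le _ _).trans (by linarith [hzb k])
  have hdb : Tendsto (fun k => ⟪d k, b k⟫_ℝ) atTop (𝓝 0) := by
    have hb0 := hPb.norm
    have hd0 := hPd.norm
    rw [norm_zero] at hb0 hd0
    have hbound : Tendsto (fun k =>
        (R + ‖d' + b'‖ + ‖V.starProjection (b k)‖) * ‖V.starProjection (b k)‖ +
        ‖d k - V.starProjection (d k)‖ * (R + ‖d' + b'‖ + ‖d k - V.starProjection (d k)‖))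
        atTop (𝓝 0) := by
      simpa using ((hb0.const_add (R + ‖d' + b'‖)).mul hb0).add
        (hd0.mul (hd0.const_add (R + ‖d' + b'‖)))
    refine squeeze_zero_norm (fun k => ?_) hbound
    rw [inner_eq_starProjection_add V]
    refine (norm_add_le _ _).trans (add_le_add ?_ ?_)
    · exact (norm_inner_le_norm _ _).trans (by gcongr; exact hPz k)
    · exact (norm_inner_le_norm _ _).trans (by gcongr; exact hQz k)
  -- Weak limits of `d k` and `b k` in terms of those of `z k`, along any filter.
  have hlim_d : ∀ (l : Filter ℕ) (y : H), l ≤ atTop →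
      (∀ p : H, Tendsto (fun k => ⟪p, d k + b k⟫_ℝ) l (𝓝 ⟪p, y⟫_ℝ)) →
      ∀ p : H, Tendsto (fun k => ⟪p, d k⟫_ℝ) l (𝓝 ⟪p, V.starProjection y⟫_ℝ) := by
    intro l y hl hy p
    have h1 := hy (V.starProjection p)
    have h2 : Tendsto (fun k => ⟪p, (d k - V.starProjection (d k)) - V.starProjection (b k)⟫_ℝ) l
        (𝓝 0) := by
      have h := ((innerSL ℝ p).continuous.tendsto 0).comp
        ((by simpa using hPd.sub hPb : Tendsto (fun k => (d k - V.starProjection (d k)) -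
          V.starProjection (b k)) atTop (𝓝 0)).mono_left hl)
      simpa [Function.comp_def] using h
    have h3 := h1.add h2
    rw [add_zero, V.inner_starProjection_left_eq_right] at h3
    refine h3.congr fun k => ?_
    rw [V.inner_starProjection_left_eq_right, ← inner_add_right, map_add]
    congr 1; abel
  have hlim_b : ∀ (l : Filter ℕ) (y : H), l ≤ atTop →
      (∀ p : H, Tendsto (fun k => ⟪p, d k + b k⟫_ℝ) l (𝓝 ⟪p, y⟫_ℝ)) →
      ∀ p : H, Tendsto (fun k => ⟪p, b k⟫_ℝ) l (𝓝 ⟪p, y - V.starProjection y⟫_ℝ) := by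
    intro l y hl hy p
    have h := (hy p).sub (hlim_d l y hl hy p)
    rw [← inner_sub_right] at h
    refine h.congr fun k => ?_
    rw [← inner_sub_right, add_sub_cancel_left]
  obtain ⟨y, hyC, hy⟩ := exists_weaklyTendsto_of_opial hzb
    {y : H | J y = V.starProjection y}
    (fun y hy => by
      obtain ⟨r, hr⟩ := hconv (V.starProjection y) (V.starProjection_apply_mem y)
        (y - V.starProjection y) (V.sub_starProjection_mem_orthogonal y) (by
          rw [add_sub_cancel]; exact hy)
      rw [add_sub_cancel] at hr
      exact ⟨r, hr⟩)
    (by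
      -- Demiclosedness: the monotonicity inequality against `(J y, y - J y)` passes to the limit
      -- because `⟪d k, b k⟫ → 0`.
      intro U y hU hy
      have h1 : ∀ k, 0 ≤ ⟪d k - J y, b k - (y - J y)⟫_ℝ := hmono (J y) (y - J y) (by simp)
      have hlimd := hlim_d U y hU hy (y - J y)
      have hlimb := hlim_b U y hU hy (J y)
      have h2 : Tendsto (fun k => ⟪d k - J y, b k - (y - J y)⟫_ℝ) U
          (𝓝 (0 - ⟪y - J y, V.starProjection y⟫_ℝ - ⟪J y, y - V.starProjection y⟫_ℝ +
            ⟪J y, y - J y⟫_ℝ)) := by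
        refine ((((hdb.mono_left hU).sub hlimd).sub hlimb).add_const ⟪J y, y - J y⟫_ℝ).congr
          fun k => ?_
        simp only [inner_sub_left, inner_sub_right, real_inner_comm (d k) y,
          real_inner_comm (d k) (J y)]
        ring
      have h3 := ge_of_tendsto' h2 h1
      have h4 := V.starProjection_inner_eq_zero y _ (V.starProjection_apply_mem y)
      have h5 : 0 - ⟪y - J y, V.starProjection y⟫_ℝ - ⟪J y, y - V.starProjection y⟫_ℝ +
            ⟪J y, y - J y⟫_ℝ = -‖J y - V.starProjection y‖ ^ 2 := by
        rw [@norm_sub_sq_real, ← real_inner_self_eq_norm_sq, ← real_inner_self_eq_norm_sq]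
        simp only [inner_sub_left, inner_sub_right] at h4 ⊢
        linarith
      rw [h5] at h3
      have h6 : ‖J y - V.starProjection y‖ = 0 := by
        have := sq_nonneg ‖J y - V.starProjection y‖
        exact pow_eq_zero_iff (two_ne_zero) |>.1 (by linarith)
      exact sub_eq_zero.1 (norm_eq_zero.1 h6))
  rw [weaklyTendsto_iff_forall_inner] at hy
  refine ⟨V.starProjection y, V.starProjection_apply_mem y, y - V.starProjection y,
    V.sub_starProjection_mem_orthogonal y, by rw [add_sub_cancel]; exact hyC,
    weaklyTendsto_iff_forall_inner.2 (hlim_d atTop y le_rfl hy),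
    weaklyTendsto_iff_forall_inner.2 (hlim_b atTop y le_rfl hy), hsum⟩

end DouglasRachford

/-! ### Optimality condition on a subspace -/

/-- If the convex continuous `F` is minimal over the subspace `V` at `d₀ ∈ V`, then `F` has a
subgradient at `d₀` that is orthogonal to `V`. -/
theorem exists_subgradient_mem_orthogonal {H : Type*} [NormedAddCommGroup H]
    [InnerProductSpace ℝ H] [CompleteSpace H] {F : H → ℝ} (hF : ConvexOn ℝ Set.univ F)
    (hFc : Continuous F) (V : Submodule ℝ H) {d₀ : H} (hd₀ : d₀ ∈ V)
    (hmin : ∀ x ∈ V, F d₀ ≤ F x) :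
    ∃ p ∈ Vᗮ, ∀ x, F d₀ + ⟪p, x - d₀⟫_ℝ ≤ F x := by
  -- The strict epigraph of `F` is separated from `V × {F d₀}`.
  obtain ⟨l, c, hl1, hl2⟩ := geometric_hahn_banach_open
    (s := {q : H × ℝ | q.1 ∈ Set.univ ∧ F q.1 < q.2}) (t := (V : Set H) ×ˢ {F d₀})
    hF.convex_strict_epigraph
    (by simpa using isOpen_lt (hFc.comp continuous_fst) continuous_snd)
    (V.convex.prod (convex_singleton _))
    (by
      rw [Set.disjoint_left]
      rintro ⟨x, t⟩ ⟨-, hx⟩ ⟨hxV, ht⟩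
      have ht' : t = F d₀ := ht
      have hx' : F x < t := hx
      linarith [hmin x hxV])
  set s : ℝ := l (0, 1) with hs
  have hl : ∀ (x : H) (t : ℝ), l (x, t) = l (x, 0) + t * s := by
    intro x t
    have h : ((x, t) : H × ℝ) = (x, 0) + t • (0, 1) := by simp
    rw [h, map_add, map_smul, smul_eq_mul]
  have hV : ∀ x ∈ V, c ≤ l (x, 0) + F d₀ * s := fun x hx => by
    rw [← hl]; exact hl2 (x, F d₀) ⟨hx, rfl⟩
  have hepi : ∀ x t, F x < t → l (x, 0) + t * s < c := fun x t ht => by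
    rw [← hl]; exact hl1 (x, t) ⟨trivial, ht⟩
  have hs0 : s < 0 := by
    have h1 := hV d₀ hd₀
    have h2 := hepi d₀ (F d₀ + 1) (by linarith)
    linarith
  let m : H →L[ℝ] ℝ := l.comp (ContinuousLinearMap.inl ℝ H ℝ)
  have hm : ∀ x, m x = l (x, 0) := fun x => rfl
  -- A linear functional that is bounded below on a subspace vanishes there.
  have hm0 : ∀ x ∈ V, m x = 0 := by
    intro x hx
    by_contra hne
    have h := hV (((c - F d₀ * s - 1) / m x) • x) (V.smul_mem _ hx)
    rw [← hm, map_smul, smul_eq_mul, div_mul_cancel₀ _ hne] at h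
    linarith
  have hc : c ≤ F d₀ * s := by simpa [hm0 0 V.zero_mem, ← hm] using hV 0 V.zero_mem
  have hle : ∀ x, m x ≤ (F x - F d₀) * (-s) := by
    intro x
    have h : ∀ t, F x < t → m x ≤ (t - F d₀) * (-s) := fun t ht => by
      have h1 := hepi x t ht
      rw [← hm] at h1
      nlinarith
    refine le_of_forall_pos_le_add fun e he => ?_
    have h1 := h (F x + e / (-s)) (by have := div_pos he (neg_pos.2 hs0); linarith)
    have h2 : (F x + e / (-s) - F d₀) * (-s) = (F x - F d₀) * (-s) + e := by
      have : e / (-s) * (-s) = e := div_mul_cancel₀ _ (by linarith)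
      linear_combination this
    linarith
  refine ⟨(-s)⁻¹ • (InnerProductSpace.toDual ℝ H).symm m, ?_, fun x => ?_⟩
  · rw [Submodule.mem_orthogonal']
    intro x hx
    rw [real_inner_smul_left, InnerProductSpace.toDual_symm_apply, hm0 x hx, mul_zero]
  · rw [real_inner_smul_left, InnerProductSpace.toDual_symm_apply, map_sub, hm0 d₀ hd₀, sub_zero]
    have h1 : (-s)⁻¹ * m x ≤ (-s)⁻¹ * ((F x - F d₀) * (-s)) :=
      mul_le_mul_of_nonneg_left (hle x) (by simpa using hs0.le)
    have h2 : (-s)⁻¹ * ((F x - F d₀) * (-s)) = F x - F d₀ := by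
      rw [mul_comm, mul_assoc, mul_inv_cancel₀ (neg_ne_zero.2 hs0.ne), mul_one]
    linarith

variable {n : ℕ} {Ω : Set (EuclideanSpace ℝ (Fin n))}

/-! ### The shrinkage operator and the functional `F` -/

theorem shrink_eq_max_smul (t : ℝ) (v : EuclideanSpace ℝ (Fin n)) :
    shrink t v = (max (‖v‖ - t) 0 / ‖v‖) • v := by
  unfold shrink
  split_ifs with h
  · rfl
  · rw [not_not.1 h, smul_zero]

theorem shrink_eq_zero_of_norm_le {t : ℝ} {v : EuclideanSpace ℝ (Fin n)} (h : ‖v‖ ≤ t) :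
    shrink t v = 0 := by
  rw [shrink_eq_max_smul, max_eq_right (by linarith), zero_div, zero_smul]

theorem norm_shrink_of_lt {t : ℝ} (ht : 0 ≤ t) {v : EuclideanSpace ℝ (Fin n)} (h : t < ‖v‖) :
    ‖shrink t v‖ = ‖v‖ - t := by
  have hv : 0 < ‖v‖ := ht.trans_lt h
  rw [shrink_eq_max_smul, max_eq_left (by linarith), norm_smul, norm_div, norm_norm,
    div_mul_cancel₀ _ hv.ne', Real.norm_of_nonneg (by linarith)]

theorem sub_shrink_of_lt {t : ℝ} (ht : 0 ≤ t) {v : EuclideanSpace ℝ (Fin n)} (h : t < ‖v‖) :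
    v - shrink t v = (t / ‖v‖) • v := by
  have hv : 0 < ‖v‖ := ht.trans_lt h
  rw [shrink_eq_max_smul, max_eq_left (by linarith), sub_div, div_self hv.ne', sub_smul, one_smul,
    sub_sub_cancel]

theorem norm_shrink_le {t : ℝ} (ht : 0 ≤ t) (v : EuclideanSpace ℝ (Fin n)) :
    ‖shrink t v‖ ≤ ‖v‖ := by
  rcases le_or_gt ‖v‖ t with h | h
  · simp [shrink_eq_zero_of_norm_le h]
  · rw [norm_shrink_of_lt ht h]; linarith

/-- `v - shrink t v` is a subgradient of `t ‖·‖` at `shrink t v`. -/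
theorem inner_sub_shrink_le {t : ℝ} (ht : 0 ≤ t) (v y : EuclideanSpace ℝ (Fin n)) :
    ⟪v - shrink t v, y - shrink t v⟫_ℝ ≤ t * (‖y‖ - ‖shrink t v‖) := by
  rcases le_or_gt ‖v‖ t with h | h
  · rw [shrink_eq_zero_of_norm_le h, sub_zero, sub_zero, norm_zero, sub_zero]
    exact (real_inner_le_norm _ _).trans (by gcongr)
  · have hv : 0 < ‖v‖ := ht.trans_lt h
    have h1 : ⟪v - shrink t v, y⟫_ℝ ≤ t * ‖y‖ := by
      rw [sub_shrink_of_lt ht h]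
      refine (real_inner_le_norm _ _).trans ?_
      rw [norm_smul, norm_div, norm_norm, div_mul_cancel₀ _ hv.ne', Real.norm_of_nonneg ht]
    have h2 : ⟪v - shrink t v, shrink t v⟫_ℝ = t * ‖shrink t v‖ := by
      rw [norm_shrink_of_lt ht h, sub_shrink_of_lt ht h, shrink_eq_max_smul,
        max_eq_left (by linarith), real_inner_smul_left, real_inner_smul_right,
        real_inner_self_eq_norm_sq]
      field_simp
    rw [inner_sub_right, h2]
    linarith

/-- Where `s = shrink t v` does not vanish, or where it vanishes together with `t`, the residual
`v - s` is `t s / ‖s‖`. -/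
theorem sub_shrink_eq {t : ℝ} (ht : 0 ≤ t) (v : EuclideanSpace ℝ (Fin n))
    (h : ¬ (‖shrink t v‖ = 0 ∧ t ≠ 0)) :
    v - shrink t v = (t / ‖shrink t v‖) • shrink t v := by
  rcases le_or_gt ‖v‖ t with hv | hv
  · have hs := shrink_eq_zero_of_norm_le hv
    have ht0 : t = 0 := by
      by_contra hne
      exact h ⟨by simp [hs], hne⟩
    have hv0 : v = 0 := norm_le_zero_iff.1 (hv.trans_eq ht0)
    rw [hs, hv0]; simp
  · have hv0 : 0 < ‖v‖ := ht.trans_lt hv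
    have hs0 : ‖v‖ - t ≠ 0 := by linarith
    rw [norm_shrink_of_lt ht hv, sub_shrink_of_lt ht hv, shrink_eq_max_smul,
      max_eq_left (by linarith), smul_smul]
    congr 1
    field_simp

theorem aestronglyMeasurable_shrink {μ : Measure (EuclideanSpace ℝ (Fin n))}
    {t : EuclideanSpace ℝ (Fin n) → ℝ} {v : EuclideanSpace ℝ (Fin n) → EuclideanSpace ℝ (Fin n)}
    (ht : AEStronglyMeasurable t μ) (hv : AEStronglyMeasurable v μ) :
    AEStronglyMeasurable (fun x => shrink (t x) (v x)) μ := by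
  simp only [shrink_eq_max_smul]
  have h1 : AEMeasurable (fun x => max (‖v x‖ - t x) 0 / ‖v x‖) μ :=
    ((hv.norm.aemeasurable.sub ht.aemeasurable).max aemeasurable_const).div hv.norm.aemeasurable
  exact h1.aestronglyMeasurable.smul hv

theorem memLp_shrink {a : L2 Ω} (ha : ∀ᵐ x ∂(volume.restrict Ω), 0 ≤ a x) {lam : ℝ}
    (hlam : 0 < lam) (v : L2Vec Ω) :
    MemLp (fun x => shrink (a x / lam) (v x)) 2 (volume.restrict Ω) := by
  refine MemLp.of_le (Lp.memLp v)
    (aestronglyMeasurable_shrink (((Lp.memLp a).1.aemeasurable.div_const lam).aestronglyMeasurable)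
      (Lp.memLp v).1) ?_
  filter_upwards [ha] with x hx
  exact norm_shrink_le (div_nonneg hx hlam.le) _

open Classical in
/-- The resolvent `z ↦ shrink (a / lam) (z + ∇u_f) - ∇u_f` of `lam⁻¹ ∂F`. The first branch is the
one that occurs: it is taken as soon as `a` is non-negative and `lam` positive. -/
noncomputable def shrinkResolvent (a : L2 Ω) (uf : H1 Ω) (lam : ℝ) (z : L2Vec Ω) : L2Vec Ω :=
  if h : MemLp (fun x => shrink (a x / lam) ((z + grad uf : L2Vec Ω) x)) 2 (volume.restrict Ω)
  then h.toLp _ - grad uf else 0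

theorem coeFn_shrinkResolvent {a : L2 Ω} (ha : ∀ᵐ x ∂(volume.restrict Ω), 0 ≤ a x) {lam : ℝ}
    (hlam : 0 < lam) (uf : H1 Ω) (z : L2Vec Ω) :
    ∀ᵐ x ∂(volume.restrict Ω), shrinkResolvent a uf lam z x =
      shrink (a x / lam) (z x + grad uf x) - grad uf x := by
  have h := memLp_shrink ha hlam (z + grad uf)
  rw [shrinkResolvent, dif_pos h]
  filter_upwards [Lp.coeFn_sub (h.toLp _) (grad uf), h.coeFn_toLp, Lp.coeFn_add z (grad uf)]
    with x h1 h2 h3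
  rw [h1, Pi.sub_apply, h2, h3, Pi.add_apply]

theorem integrable_mul_norm (a : L2 Ω) (v : L2Vec Ω) :
    Integrable (fun x => a x * ‖v x‖) (volume.restrict Ω) :=
  memLp_one_iff_integrable.1 ((Lp.memLp v).norm.mul (Lp.memLp a))

theorem functionalF_eq (a : L2 Ω) (uf : H1 Ω) (d : L2Vec Ω) :
    functionalF a uf d = ∫ x in Ω, a x * ‖(d + grad uf : L2Vec Ω) x‖ := by
  refine integral_congr_ae ?_
  filter_upwards [Lp.coeFn_add d (grad uf)] with x hx
  rw [hx, Pi.add_apply]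

theorem integrable_functionalF (a : L2 Ω) (uf : H1 Ω) (d : L2Vec Ω) :
    Integrable (fun x => a x * ‖d x + grad uf x‖) (volume.restrict Ω) := by
  refine (integrable_mul_norm a (d + grad uf)).congr ?_
  filter_upwards [Lp.coeFn_add d (grad uf)] with x hx
  rw [hx, Pi.add_apply]

theorem energy_eq_functionalF (a : L2 Ω) (uf : H1 Ω) (w : H10 Ω) :
    energy a ((w : H1 Ω) + uf) = functionalF a uf (grad0 w) := by
  rw [functionalF_eq, energy, map_add]
  rfl

theorem continuous_functionalF (a : L2 Ω) (uf : H1 Ω) : Continuous (functionalF a uf) := by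
  have hL : LipschitzWith 1 (fun v : EuclideanSpace ℝ (Fin n) => ‖v‖) := lipschitzWith_one_norm
  have h : functionalF a uf = fun d => ⟪a, hL.compLp norm_zero (d + grad uf)⟫_ℝ := by
    funext d
    rw [functionalF_eq, L2.inner_def]
    refine integral_congr_ae ?_
    filter_upwards [hL.coeFn_compLp norm_zero (d + grad uf)] with x hx
    rw [hx, real_inner_eq_re_inner, RCLike.inner_apply]
    simp [mul_comm]
  rw [h]
  exact continuous_const.inner
    ((hL.continuous_compLp norm_zero).comp (continuous_id.add continuous_const))

theorem convexOn_functionalF {a : L2 Ω} (ha : ∀ᵐ x ∂(volume.restrict Ω), 0 ≤ a x) (uf : H1 Ω) :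
    ConvexOn ℝ Set.univ (functionalF a uf) := by
  refine ⟨convex_univ, fun d _ e _ s t hs ht hst => ?_⟩
  have hd := integrable_functionalF a uf d
  have he := integrable_functionalF a uf e
  simp only [functionalF, smul_eq_mul]
  rw [← integral_const_mul, ← integral_const_mul, ← integral_add (hd.const_mul s) (he.const_mul t)]
  refine integral_mono_ae (integrable_functionalF a uf _)
    ((hd.const_mul s).add (he.const_mul t)) ?_
  filter_upwards [ha, Lp.coeFn_add (s • d) (t • e), Lp.coeFn_smul s d, Lp.coeFn_smul t e]
    with x hx h1 h2 h3
  rw [h1, Pi.add_apply, h2, h3, Pi.smul_apply, Pi.smul_apply]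
  have h4 : s • d x + t • e x + grad uf x = s • (d x + grad uf x) + t • (e x + grad uf x) := by
    have h5 : s • grad uf x + t • grad uf x = grad uf x := by rw [← add_smul, hst, one_smul]
    rw [smul_add, smul_add, add_add_add_comm, h5]
  have h6 : ‖s • d x + t • e x + grad uf x‖ ≤
      s * ‖d x + grad uf x‖ + t * ‖e x + grad uf x‖ := by
    rw [h4]
    refine (norm_add_le _ _).trans_eq ?_
    rw [norm_smul, norm_smul, Real.norm_of_nonneg hs, Real.norm_of_nonneg ht]
  refine (mul_le_mul_of_nonneg_left h6 hx).trans_eq ?_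
  ring

/-- `lam (z - J z)` is a subgradient of `F` at `J z`, where `J` is `shrinkResolvent`. -/
theorem functionalF_subgradient {a : L2 Ω} (ha : ∀ᵐ x ∂(volume.restrict Ω), 0 ≤ a x) {lam : ℝ}
    (hlam : 0 < lam) (uf : H1 Ω) (z e : L2Vec Ω) :
    functionalF a uf (shrinkResolvent a uf lam z) +
      lam * ⟪z - shrinkResolvent a uf lam z, e - shrinkResolvent a uf lam z⟫_ℝ ≤
      functionalF a uf e := by
  set s := shrinkResolvent a uf lam z with hs
  have hi : Integrable (fun x => ⟪(z - s : L2Vec Ω) x, (e - s : L2Vec Ω) x⟫_ℝ)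
    (volume.restrict Ω) := L2.integrable_inner _ _
  rw [L2.inner_def, ← integral_const_mul]
  simp only [functionalF]
  rw [← integral_add (integrable_functionalF a uf s) (hi.const_mul lam)]
  refine integral_mono_ae ((integrable_functionalF a uf s).add (hi.const_mul lam))
    (integrable_functionalF a uf e) ?_
  filter_upwards [ha, coeFn_shrinkResolvent ha hlam uf z, Lp.coeFn_sub z s, Lp.coeFn_sub e s]
    with x hx h1 h2 h3
  rw [← hs] at h1
  rw [h2, h3, Pi.sub_apply, Pi.sub_apply]
  have h4 := inner_sub_shrink_le (div_nonneg hx hlam.le) (z x + grad uf x) (e x + grad uf x)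
  have h5 : shrink (a x / lam) (z x + grad uf x) = s x + grad uf x := by rw [h1]; abel
  rw [h5, add_sub_add_right_eq_sub, add_sub_add_right_eq_sub] at h4
  have h6 := mul_le_mul_of_nonneg_left h4 hlam.le
  have h7 : lam * (a x / lam * (‖e x + grad uf x‖ - ‖s x + grad uf x‖)) =
      a x * ‖e x + grad uf x‖ - a x * ‖s x + grad uf x‖ := by
    field_simp
  linarith

theorem isFirmlyNonexpansive_shrinkResolvent {a : L2 Ω}
    (ha : ∀ᵐ x ∂(volume.restrict Ω), 0 ≤ a x) {lam : ℝ} (hlam : 0 < lam) (uf : H1 Ω) :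
    IsFirmlyNonexpansive (shrinkResolvent a uf lam) := by
  intro z w
  set p := shrinkResolvent a uf lam z
  set q := shrinkResolvent a uf lam w
  have h1 : functionalF a uf p + lam * ⟪z - p, q - p⟫_ℝ ≤ functionalF a uf q :=
    functionalF_subgradient ha hlam uf z q
  have h2 : functionalF a uf q + lam * ⟪w - q, p - q⟫_ℝ ≤ functionalF a uf p :=
    functionalF_subgradient ha hlam uf w p
  have h3 : ⟪p - q, (z - p) - (w - q)⟫_ℝ = -(⟪z - p, q - p⟫_ℝ + ⟪w - q, p - q⟫_ℝ) := by
    rw [inner_sub_right, real_inner_comm (z - p), real_inner_comm (w - q), ← neg_sub q p,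
      inner_neg_right, inner_neg_right]
    ring
  rw [h3]
  have h4 : lam * (⟪z - p, q - p⟫_ℝ + ⟪w - q, p - q⟫_ℝ) ≤ 0 := by linarith
  have h5 := nonpos_of_mul_nonpos_right h4 hlam
  linarith

/-- A subgradient inequality at `d` determines the value of the resolvent. -/
theorem shrinkResolvent_eq_of_subgradient {a : L2 Ω}
    (ha : ∀ᵐ x ∂(volume.restrict Ω), 0 ≤ a x) {lam : ℝ} (hlam : 0 < lam) (uf : H1 Ω)
    {d b : L2Vec Ω}
    (h : ∀ e, functionalF a uf d + lam * ⟪b, e - d⟫_ℝ ≤ functionalF a uf e) :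
    shrinkResolvent a uf lam (d + b) = d := by
  set p := shrinkResolvent a uf lam (d + b)
  have h1 : functionalF a uf p + lam * ⟪d + b - p, d - p⟫_ℝ ≤ functionalF a uf d :=
    functionalF_subgradient ha hlam uf (d + b) d
  have h2 := h p
  have h3 : ⟪d + b - p, d - p⟫_ℝ + ⟪b, p - d⟫_ℝ = ‖d - p‖ ^ 2 := by
    rw [← neg_sub d p, inner_neg_right, ← real_inner_self_eq_norm_sq, ← sub_eq_add_neg,
      ← inner_sub_left]
    congr 1; abel
  have h4 : lam * ‖d - p‖ ^ 2 ≤ 0 := by rw [← h3]; linarith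
  have h5 : ‖d - p‖ ^ 2 = 0 := le_antisymm (nonpos_of_mul_nonpos_right h4 hlam) (sq_nonneg _)
  exact (sub_eq_zero.1 (norm_eq_zero.1 (pow_eq_zero_iff two_ne_zero |>.1 h5))).symm

/-! ### Completeness of `H¹(Ω)` and the Poincaré inequality on `H¹₀(Ω)` -/

theorem isClosed_H1 (Ω : Set (EuclideanSpace ℝ (Fin n))) :
    IsClosed (H1 Ω : Set (WithLp 2 (L2 Ω × L2Vec Ω))) := by
  let B : ℝ →L[ℝ] EuclideanSpace ℝ (Fin n) →L[ℝ] EuclideanSpace ℝ (Fin n) :=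
    ContinuousLinearMap.lsmul ℝ ℝ
  have h : (H1 Ω : Set (WithLp 2 (L2 Ω × L2Vec Ω))) =
      ⋂ (φ : EuclideanSpace ℝ (Fin n) → ℝ) (hφ : IsTestFunction Ω φ),
        {w | B.lpPairing (volume.restrict Ω) 2 2 w.fst (hφ.memLp_gradient.toLp _) =
          -B.lpPairing (volume.restrict Ω) 2 2 (hφ.memLp.toLp _) w.snd} := by
    ext w
    simp only [Set.mem_iInter, Set.mem_ofPred_eq, SetLike.mem_coe]
    refine forall₂_congr fun φ hφ => ?_
    have h1 : B.lpPairing (volume.restrict Ω) 2 2 w.fst (hφ.memLp_gradient.toLp _) =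
        ∫ x in Ω, w.fst x • ∇ φ x := by
      rw [ContinuousLinearMap.lpPairing_eq_integral]
      refine integral_congr_ae ?_
      filter_upwards [hφ.memLp_gradient.coeFn_toLp] with x hx
      rw [hx]; rfl
    have h2 : B.lpPairing (volume.restrict Ω) 2 2 (hφ.memLp.toLp _) w.snd =
        ∫ x in Ω, φ x • w.snd x := by
      rw [ContinuousLinearMap.lpPairing_eq_integral]
      refine integral_congr_ae ?_
      filter_upwards [hφ.memLp.coeFn_toLp] with x hx
      rw [hx]; rfl
    rw [h1, h2]
  rw [h]
  have hfst : Continuous fun w : WithLp 2 (L2 Ω × L2Vec Ω) => w.fst :=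
    (WithLp.fstL 2 ℝ (L2 Ω) (L2Vec Ω)).continuous
  have hsnd : Continuous fun w : WithLp 2 (L2 Ω × L2Vec Ω) => w.snd :=
    (WithLp.sndL 2 ℝ (L2 Ω) (L2Vec Ω)).continuous
  refine isClosed_iInter fun φ => isClosed_iInter fun hφ => isClosed_eq ?_ ?_
  · exact ((B.lpPairing (volume.restrict Ω) 2 2).flip _).continuous.comp hfst
  · exact ((B.lpPairing (volume.restrict Ω) 2 2 _).continuous.comp hsnd).neg

instance : CompleteSpace (H1 Ω) := (isClosed_H1 Ω).completeSpace_coe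

instance : CompleteSpace (H10 Ω) :=
  (testSubspace Ω).isClosed_topologicalClosure.completeSpace_coe

theorem IsTestFunction.coord_mul {φ : EuclideanSpace ℝ (Fin n) → ℝ} (hφ : IsTestFunction Ω φ)
    (e : EuclideanSpace ℝ (Fin n)) : IsTestFunction Ω (fun x => ⟪e, x⟫_ℝ * φ x) where
  smooth := (contDiff_const.inner ℝ contDiff_id).mul hφ.smooth
  compact := hφ.compact.mul_left
  support := (tsupport_mul_subset_right (f := fun x => ⟪e, x⟫_ℝ)).trans hφ.support

theorem IsTestFunction.gradient_coord_mul {φ : EuclideanSpace ℝ (Fin n) → ℝ}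
    (hφ : IsTestFunction Ω φ) (e x : EuclideanSpace ℝ (Fin n)) :
    ∇ (fun x => ⟪e, x⟫_ℝ * φ x) x = ⟪e, x⟫_ℝ • ∇ φ x + φ x • e := by
  have h1 : HasFDerivAt (fun x => ⟪e, x⟫_ℝ) (innerSL ℝ e) x := (innerSL ℝ e).hasFDerivAt
  have h2 : HasFDerivAt φ (fderiv ℝ φ x) x :=
    (hφ.smooth.differentiable (by simp) x).hasFDerivAt
  have h3 : HasFDerivAt (fun x => ⟪e, x⟫_ℝ * φ x) _ x := h1.mul h2
  rw [gradient, h3.fderiv, map_add, map_smul, map_smul]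
  congr 2
  rw [LinearIsometryEquiv.symm_apply_eq]
  rfl

/-- The **Poincaré inequality** for test functions. Testing the definition of the weak gradient of
`φ` with `x₀ φ` gives `∫ φ² = -2 ∫ x₀ φ ∂₀φ`, and `|x₀| ≤ R` on `Ω`. -/
theorem norm_fst_sq_le_of_mem_testSubspace (hn : 0 < n) (hΩ : MeasurableSet Ω) {R : ℝ}
    (hR : ∀ x ∈ Ω, ‖x‖ ≤ R) {w : H1 Ω} (hw : w ∈ testSubspace Ω) :
    ‖(w : WithLp 2 (L2 Ω × L2Vec Ω)).fst‖ ^ 2 ≤ 4 * R ^ 2 * ‖grad w‖ ^ 2 := by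
  obtain ⟨φ, hφ, hw1, hw2⟩ := hw
  change (grad w : EuclideanSpace ℝ (Fin n) → EuclideanSpace ℝ (Fin n)) =ᵐ[_] ∇ φ at hw2
  set v : L2 Ω := (w : WithLp 2 (L2 Ω × L2Vec Ω)).fst
  let e : EuclideanSpace ℝ (Fin n) := EuclideanSpace.single ⟨0, hn⟩ 1
  have he : ‖e‖ = 1 := by simp [e]
  have hψ := hφ.coord_mul e
  have hweak : ∫ x in Ω, v x • ∇ (fun x => ⟪e, x⟫_ℝ * φ x) x =
      - ∫ x in Ω, (⟪e, x⟫_ℝ * φ x) • grad w x := w.2 _ hψ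
  have hi1 := integrable_smul_of_memLp (Lp.memLp v) hψ.memLp_gradient
  have hi2 := integrable_smul_of_memLp hψ.memLp (Lp.memLp (grad w))
  have hweak' := congrArg (fun y => ⟪e, y⟫_ℝ) hweak
  simp only [inner_neg_right] at hweak'
  rw [← integral_inner hi1, ← integral_inner hi2] at hweak'
  have hj1 : Integrable (fun x => ⟪e, v x • ∇ (fun x => ⟪e, x⟫_ℝ * φ x) x⟫_ℝ)
    (volume.restrict Ω) := hi1.const_inner e
  have hj2 : Integrable (fun x => ⟪e, (⟪e, x⟫_ℝ * φ x) • grad w x⟫_ℝ)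
    (volume.restrict Ω) := hi2.const_inner e
  have hv : ‖v‖ ^ 2 = ∫ x in Ω, ‖v x‖ ^ 2 := by
    rw [← real_inner_self_eq_norm_sq, L2.inner_def]
    simp only [real_inner_self_eq_norm_sq]
  have hg : ‖grad w‖ ^ 2 = ∫ x in Ω, ‖grad w x‖ ^ 2 := by
    rw [← real_inner_self_eq_norm_sq, L2.inner_def]
    simp only [real_inner_self_eq_norm_sq]
  have hiv : Integrable (fun x => ‖v x‖ ^ 2) (volume.restrict Ω) := (Lp.memLp v).integrable_norm_pow
    two_ne_zero
  have hig : Integrable (fun x => ‖grad w x‖ ^ 2) (volume.restrict Ω) :=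
    (Lp.memLp (grad w)).integrable_norm_pow two_ne_zero
  -- The Young inequality `-2 x₀ φ ∂₀φ ≤ φ² / 2 + 2 R² |∇φ|²`, integrated.
  have hle : ∫ x in Ω, ‖v x‖ ^ 2 ≤ ∫ x in Ω,
      (⟪e, v x • ∇ (fun x => ⟪e, x⟫_ℝ * φ x) x⟫_ℝ + ⟪e, (⟪e, x⟫_ℝ * φ x) • grad w x⟫_ℝ +
        (1 / 2 * ‖v x‖ ^ 2 + 2 * R ^ 2 * ‖grad w x‖ ^ 2)) := by
    refine integral_mono_ae hiv ((hj1.add hj2).add ((hiv.const_mul _).add (hig.const_mul _))) ?_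
    filter_upwards [hw1, hw2, ae_restrict_mem hΩ] with x h1 h2 hx
    rw [hφ.gradient_coord_mul, h1, h2]
    simp only [inner_smul_right, inner_add_right, real_inner_self_eq_norm_sq, he]
    have hex : |⟪e, x⟫_ℝ| ≤ R :=
      (abs_real_inner_le_norm _ _).trans (by rw [he, one_mul]; exact hR x hx)
    have heg : |⟪e, ∇ φ x⟫_ℝ| ≤ ‖∇ φ x‖ := (abs_real_inner_le_norm _ _).trans (by rw [he, one_mul])
    have hprod : (⟪e, x⟫_ℝ * ⟪e, ∇ φ x⟫_ℝ) ^ 2 ≤ R ^ 2 * ‖∇ φ x‖ ^ 2 := by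
      rw [mul_pow, ← sq_abs ⟪e, x⟫_ℝ, ← sq_abs ⟪e, ∇ φ x⟫_ℝ]
      gcongr
    rw [Real.norm_eq_abs, sq_abs]
    nlinarith [sq_nonneg (φ x + 2 * (⟪e, x⟫_ℝ * ⟪e, ∇ φ x⟫_ℝ))]
  have hsplit := (integral_add (hj1.add hj2)
    ((hiv.const_mul (1 / 2)).add (hig.const_mul (2 * R ^ 2)))).trans
    (congrArg₂ (fun s t : ℝ => s + t) (integral_add hj1 hj2)
      (integral_add (hiv.const_mul (1 / 2)) (hig.const_mul (2 * R ^ 2))))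
  have hle' := hle.trans_eq hsplit
  simp only [integral_const_mul, hweak', ← hv, ← hg] at hle'
  linarith

theorem norm_fst_sq_le (hn : 0 < n) (hΩ : MeasurableSet Ω) {R : ℝ}
    (hR : ∀ x ∈ Ω, ‖x‖ ≤ R) (w : H10 Ω) :
    ‖((w : H1 Ω) : WithLp 2 (L2 Ω × L2Vec Ω)).fst‖ ^ 2 ≤ 4 * R ^ 2 * ‖grad0 w‖ ^ 2 := by
  have hfst : Continuous fun w : H1 Ω => (w : WithLp 2 (L2 Ω × L2Vec Ω)).fst :=
    (WithLp.fstL 2 ℝ (L2 Ω) (L2Vec Ω)).continuous.comp continuous_subtype_val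
  have hcl : IsClosed {w : H1 Ω |
      ‖(w : WithLp 2 (L2 Ω × L2Vec Ω)).fst‖ ^ 2 ≤ 4 * R ^ 2 * ‖grad w‖ ^ 2} :=
    isClosed_le (hfst.norm.pow 2) (continuous_const.mul (grad.continuous.norm.pow 2))
  have hsub : (testSubspace Ω : Set (H1 Ω)) ⊆ {w : H1 Ω |
      ‖(w : WithLp 2 (L2 Ω × L2Vec Ω)).fst‖ ^ 2 ≤ 4 * R ^ 2 * ‖grad w‖ ^ 2} := fun w hw =>
    norm_fst_sq_le_of_mem_testSubspace hn hΩ hR hw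
  exact closure_minimal hsub hcl w.2

theorem exists_antilipschitzWith_grad0 (hn : 0 < n) (hΩ : MeasurableSet Ω)
    (hΩb : Bornology.IsBounded Ω) :
    ∃ K, AntilipschitzWith K (grad0 : H10 Ω →L[ℝ] L2Vec Ω) := by
  obtain ⟨R, hR⟩ := hΩb.exists_norm_le
  refine ⟨(Real.sqrt (4 * R ^ 2 + 1)).toNNReal,
    (grad0 : H10 Ω →L[ℝ] L2Vec Ω).antilipschitz_of_bound fun w => ?_⟩
  have h1 : ‖w‖ ^ 2 = ‖((w : H1 Ω) : WithLp 2 (L2 Ω × L2Vec Ω)).fst‖ ^ 2 + ‖grad0 w‖ ^ 2 :=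
    WithLp.prod_norm_sq_eq_of_L2 ((w : H1 Ω) : WithLp 2 (L2 Ω × L2Vec Ω))
  have h2 := norm_fst_sq_le hn hΩ hR w
  rw [Real.coe_toNNReal _ (Real.sqrt_nonneg _)]
  refine le_of_sq_le_sq ?_ (by positivity)
  rw [mul_pow, Real.sq_sqrt (by positivity)]
  linarith

/-! ### Divergence-free fields and the dual problem -/

/-- The space `∇H¹₀(Ω)` of gradients. -/
noncomputable def gradientSpace (Ω : Set (EuclideanSpace ℝ (Fin n))) : Submodule ℝ (L2Vec Ω) :=
  LinearMap.range (grad0 : H10 Ω →L[ℝ] L2Vec Ω).toLinearMap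

theorem grad0_mem_gradientSpace (w : H10 Ω) : grad0 w ∈ gradientSpace Ω := ⟨w, rfl⟩

theorem divergence_eq_iff {p q : L2Vec Ω} :
    divergence p = divergence q ↔ p - q ∈ (gradientSpace Ω)ᗮ := by
  rw [Submodule.mem_orthogonal']
  constructor
  · rintro h _ ⟨w, rfl⟩
    have h1 : -⟪p, grad0 w⟫_ℝ = -⟪q, grad0 w⟫_ℝ := congrArg (fun l => l w) h
    rw [inner_sub_left]
    change ⟪p, grad0 w⟫_ℝ - ⟪q, grad0 w⟫_ℝ = 0
    linarith
  · intro h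
    ext w
    have h1 := h _ (grad0_mem_gradientSpace w)
    rw [inner_sub_left] at h1
    change -⟪p, grad0 w⟫_ℝ = -⟪q, grad0 w⟫_ℝ
    linarith

theorem divergence_zero : divergence (0 : L2Vec Ω) = 0 := by
  ext w
  change -⟪(0 : L2Vec Ω), grad0 w⟫_ℝ = 0
  rw [inner_zero_left, neg_zero]

theorem divergence_eq_zero_iff {p : L2Vec Ω} :
    divergence p = 0 ↔ p ∈ (gradientSpace Ω)ᗮ := by
  rw [← divergence_zero, divergence_eq_iff, sub_zero]

theorem IsPoissonSolution.grad0_eq [(gradientSpace Ω).HasOrthogonalProjection] {p : L2Vec Ω}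
    {w : H10 Ω} (h : IsPoissonSolution p w) :
    grad0 w = (gradientSpace Ω).starProjection p := by
  refine (Submodule.eq_starProjection_of_mem_orthogonal (grad0_mem_gradientSpace w) ?_).symm
  rw [← neg_sub]
  exact Submodule.neg_mem _ (divergence_eq_iff.1 h)

theorem fenchelConj_functionalG_zero : fenchelConj (E := H10 Ω) functionalG 0 = 0 := by
  simp [fenchelConj, functionalG]

theorem fenchelConj_functionalG_of_ne_zero {l : StrongDual ℝ (H10 Ω)} (hl : l ≠ 0) :
    fenchelConj (E := H10 Ω) functionalG l = ⊤ := by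
  obtain ⟨w, hw⟩ : ∃ w, l w ≠ 0 := by
    by_contra! h
    exact hl (ContinuousLinearMap.ext h)
  refine EReal.eq_top_iff_forall_lt _ |>.2 fun c => ?_
  refine lt_of_lt_of_le ?_ (le_iSup _ (((c + 1) / l w) • w))
  rw [map_smul, smul_eq_mul, div_mul_cancel₀ _ hw, functionalG, sub_zero]
  exact_mod_cast lt_add_one c

theorem le_fenchelConj {E : Type*} [NormedAddCommGroup E] [NormedSpace ℝ E] (F : E → ℝ)
    (l : StrongDual ℝ E) (d : E) : ((l d - F d : ℝ) : EReal) ≤ fenchelConj F l :=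
  le_iSup (fun d : E => ((l d - F d : ℝ) : EReal)) d

/-- A divergence-free subgradient of `F` at a gradient solves the dual problem: the value of the
dual objective there is `-F d`, and it is at least that for every divergence-free field. -/
theorem isDualSolution_of_subgradient {a : L2 Ω} {uf : H1 Ω} {d p : L2Vec Ω}
    (hd : d ∈ gradientSpace Ω) (hp : p ∈ (gradientSpace Ω)ᗮ)
    (h : ∀ e, functionalF a uf d + ⟪p, e - d⟫_ℝ ≤ functionalF a uf e) :
    IsDualSolution a uf p := by
  have hpd : ⟪p, d⟫_ℝ = 0 := (Submodule.mem_orthogonal' _ _).1 hp d hd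
  intro c
  unfold dualObjective
  rw [divergence_eq_zero_iff.2 hp, neg_zero, fenchelConj_functionalG_zero, zero_add]
  have hle : fenchelConj (functionalF a uf) (innerSL ℝ p) ≤
      ((-functionalF a uf d : ℝ) : EReal) := by
    refine iSup_le fun e => EReal.coe_le_coe_iff.2 ?_
    have h1 := h e
    rw [inner_sub_right, hpd] at h1
    rw [innerSL_apply_apply]
    linarith
  by_cases hc : divergence c = 0
  · rw [hc, neg_zero, fenchelConj_functionalG_zero, zero_add]
    refine hle.trans ?_
    have h2 := le_fenchelConj (functionalF a uf) (innerSL ℝ c) d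
    have hcd : ⟪c, d⟫_ℝ = 0 := (Submodule.mem_orthogonal' _ _).1 (divergence_eq_zero_iff.1 hc) d hd
    rwa [innerSL_apply_apply, hcd, zero_sub] at h2
  · have hc' : -divergence c ≠ 0 := fun h0 => hc (ContinuousLinearMap.ext fun w => by
      have h2 : -divergence c w = 0 := DFunLike.congr_fun h0 w
      exact neg_eq_zero.1 h2)
    rw [fenchelConj_functionalG_of_ne_zero hc', EReal.top_add_of_ne_bot]
    · exact le_top
    · intro hbot
      have h2 := le_fenchelConj (functionalF a uf) (innerSL ℝ c) 0
      rw [hbot, le_bot_iff] at h2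
      exact EReal.coe_ne_bot _ h2

/-- A gradient at which `F` has a divergence-free subgradient is the gradient of a solution of the
weighted least gradient problem, up to the shift by `u_f`. -/
theorem isLeastGradientSolution_of_subgradient {a : L2 Ω} {uf : H1 Ω} {w : H10 Ω} {p : L2Vec Ω}
    (hp : p ∈ (gradientSpace Ω)ᗮ)
    (h : ∀ e, functionalF a uf (grad0 w) + ⟪p, e - grad0 w⟫_ℝ ≤ functionalF a uf e) :
    IsLeastGradientSolution a (trace uf) ((w : H1 Ω) + uf) := by
  have htr : ∀ v : H1 Ω, trace v = trace uf ↔ v - uf ∈ H10 Ω := fun v =>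
    Submodule.Quotient.eq (H10 Ω)
  refine ⟨(htr _).2 (by simp), fun v hv => ?_⟩
  have hv' : v = ((⟨v - uf, (htr v).1 hv⟩ : H10 Ω) : H1 Ω) + uf := by simp
  rw [hv', energy_eq_functionalF, energy_eq_functionalF]
  have h1 := h (grad0 ⟨v - uf, (htr v).1 hv⟩)
  rw [← map_sub, (Submodule.mem_orthogonal' _ _).1 hp _ (grad0_mem_gradientSpace _)] at h1
  linarith

/-- Existence of a solution of the weighted least gradient problem yields a fixed point of the
Douglas–Rachford map. -/
theorem exists_shrinkResolvent_eq {a : L2 Ω} (ha : ∀ᵐ x ∂(volume.restrict Ω), 0 ≤ a x) {lam : ℝ}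
    (hlam : 0 < lam) {uf v : H1 Ω} (hv : IsLeastGradientSolution a (trace uf) v) :
    ∃ d ∈ gradientSpace Ω, ∃ b ∈ (gradientSpace Ω)ᗮ,
      shrinkResolvent a uf lam (d + b) = d := by
  have hmem : v - uf ∈ H10 Ω := (Submodule.Quotient.eq (H10 Ω)).1 hv.1
  let w : H10 Ω := ⟨v - uf, hmem⟩
  have hvw : v = (w : H1 Ω) + uf := by simp [w]
  obtain ⟨p, hp, hsub⟩ := exists_subgradient_mem_orthogonal (convexOn_functionalF ha uf)
    (continuous_functionalF a uf) (gradientSpace Ω) (grad0_mem_gradientSpace w) (by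
      rintro _ ⟨y, rfl⟩
      have htr : trace ((y : H1 Ω) + uf) = trace uf :=
        (Submodule.Quotient.eq (H10 Ω)).2 (by simp)
      have h1 := hv.2 _ htr
      rwa [hvw, energy_eq_functionalF, energy_eq_functionalF] at h1)
  refine ⟨grad0 w, grad0_mem_gradientSpace w, lam⁻¹ • p, Submodule.smul_mem _ _ hp,
    shrinkResolvent_eq_of_subgradient ha hlam uf fun e => ?_⟩
  rw [real_inner_smul_left, mul_inv_cancel_left₀ hlam.ne']
  exact hsub e

/-! ### Convergence of the split Bregman iteration -/

theorem isClosed_gradientSpace (hn : 0 < n) (hΩ : MeasurableSet Ω)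
    (hΩb : Bornology.IsBounded Ω) : IsClosed (gradientSpace Ω : Set (L2Vec Ω)) := by
  obtain ⟨K, hK⟩ := exists_antilipschitzWith_grad0 hn hΩ hΩb
  exact hK.isClosed_range (grad0 : H10 Ω →L[ℝ] L2Vec Ω).uniformContinuous

/-- By the Poincaré inequality `u ∈ H¹₀(Ω)` depends continuously on `∇u`. -/
theorem exists_clm_grad0_leftInverse (hn : 0 < n) (hΩ : MeasurableSet Ω)
    (hΩb : Bornology.IsBounded Ω) [(gradientSpace Ω).HasOrthogonalProjection] :
    ∃ S : L2Vec Ω →L[ℝ] H10 Ω, ∀ w, S (grad0 w) = w := by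
  obtain ⟨K, hK⟩ := exists_antilipschitzWith_grad0 hn hΩ hΩb
  have hcl := hK.isClosed_range (grad0 : H10 Ω →L[ℝ] L2Vec Ω).uniformContinuous
  obtain ⟨S, hS⟩ : ∃ S : gradientSpace Ω →L[ℝ] H10 Ω, ∀ w,
      S ⟨grad0 w, grad0_mem_gradientSpace w⟩ = w :=
    ⟨((grad0 : H10 Ω →L[ℝ] L2Vec Ω).equivRange hK.injective hcl).symm.toContinuousLinearMap,
      fun w => ((grad0 : H10 Ω →L[ℝ] L2Vec Ω).equivRange hK.injective hcl).symm_apply_apply w⟩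
  refine ⟨S.comp (gradientSpace Ω).orthogonalProjectionOnto, fun w => ?_⟩
  rw [ContinuousLinearMap.comp_apply]
  have h := (gradientSpace Ω).orthogonalProjectionOnto_mem_subspace_eq_self
    ⟨grad0 w, grad0_mem_gradientSpace w⟩
  exact (congrArg S h).trans (hS w)

theorem IsApproxSplitBregman.shrinkResolvent_eq {a : L2 Ω}
    (ha : ∀ᵐ x ∂(volume.restrict Ω), 0 ≤ a x) {uf : H1 Ω} {lam : ℝ} (hlam : 0 < lam)
    {α : ℕ → ℝ} {u : ℕ → H10 Ω} {d b : ℕ → L2Vec Ω} (h : IsApproxSplitBregman a uf lam α u d b)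
    (k : ℕ) : shrinkResolvent a uf lam (d (k + 1) + b (k + 1)) = d (k + 1) := by
  have hz : d (k + 1) + b (k + 1) = grad0 (u (k + 1)) + b k := by rw [h.step_b k]; abel
  rw [hz]
  refine Lp.ext ?_
  filter_upwards [coeFn_shrinkResolvent ha hlam uf (grad0 (u (k + 1)) + b k), h.step_d k,
    Lp.coeFn_add (grad0 (u (k + 1))) (b k)] with x h1 h2 h3
  rw [h1, h2, h3, Pi.add_apply]
  congr 2
  abel

/-- The distance of `∇u^{k+1}` to the projection of `d^k - b^k` onto the gradients is the error
made in the first step of the algorithm. -/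
theorem IsApproxSplitBregman.norm_sub_starProjection_le
    [(gradientSpace Ω).HasOrthogonalProjection] {a : L2 Ω} {uf : H1 Ω} {lam : ℝ} {α : ℕ → ℝ}
    {u : ℕ → H10 Ω} {d b : ℕ → L2Vec Ω} (h : IsApproxSplitBregman a uf lam α u d b) (k : ℕ) :
    ‖grad0 (u (k + 1)) - (gradientSpace Ω).starProjection (d k - b k)‖ ≤ α (k + 1) := by
  obtain ⟨uex, h1, h2⟩ := h.step_u k
  rwa [h1.grad0_eq] at h2

theorem summable_norm_sub_sq {H : Type*} [NormedAddCommGroup H] [InnerProductSpace ℝ H]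
    (V : Submodule ℝ H) [V.HasOrthogonalProjection] {g d b : ℕ → H} {ε : ℕ → ℝ}
    (hε : Summable ε) (hg : ∀ k, ‖g k - V.starProjection (d k - b k)‖ ≤ ε k)
    (hsum : Summable fun k => ‖(d k - V.starProjection (d k)) + V.starProjection (b k)‖ ^ 2) :
    Summable fun k => ‖g k - d k‖ ^ 2 := by
  have hε2 : Summable fun k => ε k ^ 2 := by
    obtain ⟨M, hM⟩ := hε.tendsto_atTop_zero.bddAbove_range
    refine Summable.of_nonneg_of_le (fun k => sq_nonneg _) (fun k => ?_) (hε.mul_left M)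
    rw [sq]
    exact mul_le_mul_of_nonneg_right (hM ⟨k, rfl⟩) ((norm_nonneg _).trans (hg k))
  refine Summable.of_nonneg_of_le (fun k => sq_nonneg _) (fun k => ?_)
    ((hε2.mul_left 2).add (hsum.mul_left 2))
  have h1 : g k - d k = (g k - V.starProjection (d k - b k)) -
      ((d k - V.starProjection (d k)) + V.starProjection (b k)) := by
    rw [map_sub]; abel
  rw [h1]
  refine (pow_le_pow_left₀ (norm_nonneg _) (norm_sub_le _ _) 2).trans ?_
  refine add_sq_le.trans ?_
  have h2 := pow_le_pow_left₀ (norm_nonneg _) (hg k) 2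
  linarith

/-- At a fixed point, the residual `b` of the shrinkage is the normalised gradient times
`a / lam`. -/
theorem eq_smul_of_shrinkResolvent_eq {a : L2 Ω} (ha : ∀ᵐ x ∂(volume.restrict Ω), 0 ≤ a x)
    {lam : ℝ} (hlam : 0 < lam) {uf : H1 Ω} {d b : L2Vec Ω}
    (hJ : shrinkResolvent a uf lam (d + b) = d) :
    ∀ᵐ x ∂(volume.restrict Ω), ¬ (‖(d + grad uf : L2Vec Ω) x‖ = 0 ∧ a x ≠ 0) →
      b x = (1 / lam) • ((a x / ‖(d + grad uf : L2Vec Ω) x‖) • (d + grad uf : L2Vec Ω) x) := by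
  have hJx := coeFn_shrinkResolvent ha hlam uf (d + b)
  rw [hJ] at hJx
  filter_upwards [ha, hJx, Lp.coeFn_add d (grad uf), Lp.coeFn_add d b] with x hax h1 h2 h3 hne
  rw [h2, Pi.add_apply] at hne ⊢
  rw [h3, Pi.add_apply] at h1
  have h4 : shrink (a x / lam) (d x + b x + grad uf x) = d x + grad uf x := by
    rw [eq_sub_iff_add_eq] at h1
    exact h1.symm
  have h5 := sub_shrink_eq (div_nonneg hax hlam.le) (d x + b x + grad uf x) (by
    rw [h4]
    exact fun h => hne ⟨h.1, fun h0 => h.2 (by rw [h0, zero_div])⟩)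
  rw [h4] at h5
  have h6 : d x + b x + grad uf x - (d x + grad uf x) = b x := by abel
  rw [h6] at h5
  rw [h5, smul_smul]
  congr 1
  field_simp

end SplitBregman

open SplitBregman
theorem theorem4p2 {n : ℕ} (hn : 2 ≤ n) (Ω : Set (EuclideanSpace ℝ (Fin n)))
    (hΩo : IsOpen Ω) (hΩb : Bornology.IsBounded Ω)
    (a : L2 Ω) (ha : ∀ᵐ x ∂(volume.restrict Ω), 0 ≤ a x)
    (f : BoundaryValues Ω) (hP : ∃ v : H1 Ω, IsLeastGradientSolution a f v)
    (lam : ℝ) (hlam : 0 < lam)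
    (α : ℕ → ℝ) (hα : Summable fun k => α (k + 1))
    (uf : H1 Ω) (huf : trace uf = f)
    (u : ℕ → H10 Ω) (d b : ℕ → L2Vec Ω)
    (halg : IsApproxSplitBregman a uf lam α u d b) :
    ∃ (bhat dhat : L2Vec Ω) (uhat : H10 Ω),
      WeaklyTendsto b bhat ∧ WeaklyTendsto d dhat ∧ WeaklyTendsto u uhat ∧
      Tendsto (fun k => grad0 (u (k + 1)) - d k) atTop (𝓝 0) ∧
      (Summable fun k => ‖grad0 (u (k + 1)) - d k‖ ^ 2) ∧
      IsLeastGradientSolution a f ((uhat : H1 Ω) + uf) ∧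
      IsDualSolution a uf (lam • bhat) ∧
      dhat = grad0 uhat ∧
      divergence bhat = 0 ∧
      ∀ᵐ x ∂(volume.restrict Ω),
        ¬ (‖grad ((uhat : H1 Ω) + uf) x‖ = 0 ∧ a x ≠ 0) →
          bhat x = (1 / lam) •
            ((a x / ‖grad ((uhat : H1 Ω) + uf) x‖) • grad ((uhat : H1 Ω) + uf) x) := by
  subst huf
  obtain ⟨v, hv⟩ := hP
  have hn0 : 0 < n := by omega
  have hcomplete : CompleteSpace (gradientSpace Ω) :=
    (isClosed_gradientSpace hn0 hΩo.measurableSet hΩb).completeSpace_coe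
  obtain ⟨S, hS⟩ := exists_clm_grad0_leftInverse hn0 hΩo.measurableSet hΩb
  have herr := halg.norm_sub_starProjection_le
  have hα1 : Summable fun k => α (k + 1 + 1) := (summable_nat_add_iff 1).2 hα
  obtain ⟨d', hd', b', hb', hfix⟩ := exists_shrinkResolvent_eq ha hlam hv
  -- The relation `d k = J (d k + b k)` holds only from `k = 1` on, hence the shift.
  obtain ⟨dhat, hdV, bhat, hbV, hJ, hdw, hbw, hsum⟩ :=
    exists_weaklyTendsto_douglasRachford (gradientSpace Ω)
      (isFirmlyNonexpansive_shrinkResolvent ha hlam uf) hd' hb' hfix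
      (d := fun k => d (k + 1)) (b := fun k => b (k + 1)) (ε := fun k => α (k + 1 + 1))
      hα1 (fun k => (halg.shrinkResolvent_eq ha hlam k).symm)
      (fun k => by
        refine le_of_eq_of_le (congrArg norm ?_) (herr (k + 1))
        rw [halg.step_b (k + 1), map_sub]
        abel)
  obtain ⟨uhat, huhat⟩ : ∃ w : H10 Ω, grad0 w = dhat := hdV
  have hres : Summable fun k => ‖grad0 (u (k + 1)) - d k‖ ^ 2 := by
    rw [← summable_nat_add_iff 1]
    exact summable_norm_sub_sq (gradientSpace Ω) hα1 (fun k => herr (k + 1)) hsum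
  have hres0 : Tendsto (fun k => grad0 (u (k + 1)) - d k) atTop (𝓝 0) := by
    rw [tendsto_zero_iff_norm_tendsto_zero]
    simpa using hres.tendsto_atTop_zero.sqrt
  have hdw' : WeaklyTendsto d dhat := hdw.of_shift
  have huw : WeaklyTendsto u uhat := by
    have h1 := (hdw'.add_of_tendsto_zero hres0).map S
    simp only [add_sub_cancel, hS, ← huhat] at h1
    exact h1.of_shift
  have hsub : ∀ e, functionalF a uf dhat + inner ℝ (lam • bhat) (e - dhat) ≤
      functionalF a uf e := by
    intro e
    have h := functionalF_subgradient ha hlam uf (dhat + bhat) e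
    rwa [hJ, add_sub_cancel_left, ← real_inner_smul_left] at h
  have hg : grad ((uhat : H1 Ω) + uf) = dhat + grad uf := by rw [map_add, ← huhat]; rfl
  refine ⟨bhat, dhat, uhat, hbw.of_shift, hdw', huw, hres0, hres,
    isLeastGradientSolution_of_subgradient (Submodule.smul_mem _ lam hbV) (by rwa [huhat]),
    isDualSolution_of_subgradient (huhat ▸ grad0_mem_gradientSpace uhat)
      (Submodule.smul_mem _ lam hbV) hsub, huhat.symm,
    divergence_eq_zero_iff.2 hbV, ?_⟩
  rw [hg]
  exact eq_smul_of_shrinkResolvent_eq ha hlam hJ
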